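/- **The problem.** Let $n\ge 1$, $m\ge 2$, $N=\{1,\dots,n\}$, $M=\{1,\dots,m\}$, let $\phi:\mathbb R\to\mathbb R$ be continuous and convex, $R\in\mathbb R$, and $b\in\mathbb R^n$ with $b_1\ge\dots\ge b_n$. For each $i\in N$ let $[l_{i,1},u_{i,1}],\dots,[l_{i,m},u_{i,m}]$ be non-empty disjoint intervals, numbered from left to right, with $l_{i,j}=\tilde l_j$ for all $j\ne 1$ and $u_{i,j}=\tilde u_j$ for all $j\ne m$ (so the interval pattern is common to all variables except for the first and last intervals). RAP-DIBC asks to minimize $\sum_{i\in N}\phi(x_i+b_i)$ over all $x\in\mathbb R^n$ with $\sum_{i\in N}x_i=R$ and $x_i\in\bigcup_{j\in M}[l_{i,j},u_{i,j}]$ for all $i\in N$. Put $g=\max_{j<m}(\tilde l_{j+1}-\tilde u_j)$ and consider the conditions - (F1) $l_{s,1}\le l_{t,1}$ whenever $s<t$; (F2) $\min_{i}(u_{i,1}-l_{i,1})\ge g$; - (L1) $u_{s,m}\le u_{t,m}$ whenever $s<t$; (L2) $\min_{i}(u_{i,m}-l_{i,m})\ge g$. **The algorithm.** A partition vector $K=(K_1,\dots,K_{m-1})$,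 $0\le K_1\le\dots\le K_{m-1}\le n$, assigns activity $i$ to the interval $j^K(i)=j$ with $K_{j-1}<i\le K_j$ (where $K_0=0$, $K_m=n$). The algorithm runs through all $K'=(K_1,\dots,K_{m-2})$ with $0\le K_1\le\dots\le K_{m-2}\le n$. For each $K'$ it treats the partition vectors $K=(K',K_{m-1})$, $K_{m-1}=K_{m-2},K_{m-2}+1,\dots,n$, in one sequential breakpoint search. For each $K$ it determines the multiplier $\lambda^K$ with $\sum_i x_i(K,\lambda^K)=R$, where $x_i(K,\lambda)$ is the point of $[l_{i,j^K(i)},u_{i,j^K(i)}]$ nearest to $\lambda-b_i$, together with the value $V^K=\sum_i\phi(x_i(K,\lambda^K)+b_i)$; it puts $V^K=\infty$ if the subproblem is infeasible. The breakpoints $l_{i,j^K(i)}+b_i$ and $u_{i,j^K(i)}+b_i$ are kept in two priority queues and are processed in non-decreasing order, updating bookkeeping sums. When $K_{m-1}$ increases by one, only the contribution of the one activity that changes its interval is updated, its outdated breakpoints are discarded when they reach the front of a queue, and the search goes on from $\lambda^K$. Finally the algorithm returns $x(K,\lambda^K)$ for a $K$ with minimal $V^K$, or reports "infeasible" if all $V^K$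 are $\infty$. **Running time.** Each real arithmetic operation, comparison, memory access and allocation of a list cell or tree node takes one unit of time, and each evaluation of $\phi$ takes $F\ge 1$ units. **Theorem.** There is an absolute constant $C$ such that for every instance satisfying one of (F1,L1), (F1,L2), (F2,L1), (F2,L2), the algorithm returns an optimal solution of RAP-DIBC if the instance is feasible and reports infeasibility otherwise, in time at most $$C\binom{n+m-2}{m-2}\,(n\log n+nF).$$ -/

import Mathlib

/-! ## The resource allocation problem with disjoint interval bound constraints -/

/-- An instance of RAP-DIBC with `n` activities and `m > 1` intervals per activity
(activities and intervals are numbered from `0`).  All intervals are the same for every activity,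
except for the lower end of the first and the upper end of the last interval. -/
structure RapDibc (n m : ℕ) where
  /-- the cost function -/
  φ : ℝ → ℝ
  /-- the shift vector -/
  b : Fin n → ℝ
  /-- lower interval ends -/
  l : Fin n → Fin m → ℝ
  /-- upper interval ends -/
  u : Fin n → Fin m → ℝ
  /-- the amount of resource -/
  R : ℝ
  two_le : 2 ≤ m
  φ_continuous : Continuous φ
  φ_convex : ConvexOn ℝ Set.univ φ
  b_antitone : Antitone b
  l_le_u : ∀ i j, l i j ≤ u i j
  /-- the intervals of an activity are disjoint and numbered from left to right -/
  u_lt_l : ∀ i (j j' : Fin m), j < j' → u i j < l i j'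
  /-- the lower ends, except those of the first interval, do not depend on the activity -/
  l_common : ∀ i i' (j : Fin m), 0 < (j : ℕ) → l i j = l i' j
  /-- the upper ends, except those of the last interval, do not depend on the activity -/
  u_common : ∀ i i' (j : Fin m), (j : ℕ) + 1 < m → u i j = u i' j

namespace RapDibc

variable {n m : ℕ}

/-- the first interval -/
def first (P : RapDibc n m) : Fin m := ⟨0, Nat.lt_of_lt_of_le Nat.zero_lt_two P.two_le⟩

/-- the last interval -/
def last (P : RapDibc n m) : Fin m := ⟨m - 1, by have := P.two_le; omega⟩

/-- the last but one interval -/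
def penult (P : RapDibc n m) : Fin m := ⟨m - 2, by have := P.two_le; omega⟩

/-- The objective function. -/
def objective (P : RapDibc n m) (x : Fin n → ℝ) : ℝ := ∑ i, P.φ (x i + P.b i)

/-- The constraints. -/
def Feasible (P : RapDibc n m) (x : Fin n → ℝ) : Prop :=
  ∑ i, x i = P.R ∧ ∀ i, ∃ j, x i ∈ Set.Icc (P.l i j) (P.u i j)

/-- `x` is an optimal solution. -/
def IsOptimal (P : RapDibc n m) (x : Fin n → ℝ) : Prop :=
  P.Feasible x ∧ ∀ y, P.Feasible y → P.objective x ≤ P.objective y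

/-- `d` bounds the distance between any two consecutive intervals. -/
def GapsLE (P : RapDibc n m) (d : ℝ) : Prop :=
  ∀ i (j j' : Fin m), (j : ℕ) + 1 = (j' : ℕ) → P.l i j' - P.u i j ≤ d

/-- (F1): the lower ends of the first intervals are non-decreasing. -/
def F1 (P : RapDibc n m) : Prop := ∀ s t, s < t → P.l s P.first ≤ P.l t P.first

/-- (F2): every first interval is at least as long as every gap between consecutive intervals. -/
def F2 (P : RapDibc n m) : Prop := ∀ i, P.GapsLE (P.u i P.first - P.l i P.first)

/-- (L1), the mirror image of (F1) under `x ↦ -x` (which reverses the order of the intervals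
and, since `b` stays non-increasing, of the activities). -/
def L1 (P : RapDibc n m) : Prop := ∀ s t, s < t → P.u s P.last ≤ P.u t P.last

/-- (L2): every last interval is at least as long as every gap between consecutive intervals. -/
def L2 (P : RapDibc n m) : Prop := ∀ i, P.GapsLE (P.u i P.last - P.l i P.last)

/-- A correct answer: an optimal solution, or the report `none` that the instance is infeasible. -/
def IsCorrectAnswer (P : RapDibc n m) : Option (Fin n → ℝ) → Prop
  | some x => P.IsOptimal x
  | none => ¬ ∃ x, P.Feasible x

end RapDibc

/-! ## Running time

The cost model is that of a real random access machine: every arithmetic operation, comparison,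
memory access and every allocation of a list cell or of a tree node takes one unit of time; an
evaluation of the cost function takes as many units as one such evaluation takes flops. -/

/-- A computation: its result and the time that it takes. -/
structure Timed (α : Type) where
  val : α
  time : ℕ

namespace Timed

instance : Monad Timed where
  pure a := ⟨a, 0⟩
  bind x f := ⟨(f x.val).val, x.time + (f x.val).time⟩

/-- Spend `k` units of time. -/
def tick (k : ℕ) : Timed Unit := ⟨(), k⟩

/-- One elementary operation with result `a` (memory access, allocation, increment). -/
def op {α : Type} (a : α) : Timed α := ⟨a, 1⟩

noncomputable def add (x y : ℝ) : Timed ℝ := op (x + y)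

noncomputable def sub (x y : ℝ) : Timed ℝ := op (x - y)

noncomputable def mul (x y : ℝ) : Timed ℝ := op (x * y)

noncomputable def div (x y : ℝ) : Timed ℝ := op (x / y)

def le {α : Type} [LinearOrder α] (x y : α) : Timed Bool := op (decide (x ≤ y))

def lt {α : Type} [LinearOrder α] (x y : α) : Timed Bool := op (decide (x < y))

def eq {α : Type} [LinearOrder α] (x y : α) : Timed Bool := op (decide (x = y))

/-- Writing an entry of an array. -/
def write {n : ℕ} {α : Type} (a : Fin n → α) (i : Fin n) (v : α) : Timed (Fin n → α) :=
  op (Function.update a i v)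

/-- Repeat `body` until it delivers a result, but at most the given number of times. -/
def repeatUntil {σ ρ : Type} (body : σ → Timed (σ × Option ρ)) : ℕ → σ → Timed (σ × Option ρ)
  | 0, s => pure (s, none)
  | k + 1, s => do
    tick 1
    let p ← body s
    match p.2 with
    | some r => pure (p.1, some r)
    | none => repeatUntil body k p.1

end Timed

/-! ## Priority queues (leftist heaps) of breakpoints -/

/-- A priority queue of breakpoints, each given by its value `key` and its activity `idx`. -/
inductive BpQueue (n : ℕ) where
  | nil : BpQueue n
  | node (rank : ℕ) (key : ℝ) (idx : Fin n) (left right : BpQueue n) : BpQueue n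

namespace BpQueue

open Timed

variable {n : ℕ}

/-- The rank that is stored in the root. -/
def rank : BpQueue n → ℕ
  | nil => 0
  | node r _ _ _ _ => r

/-- The heap with a given root and two given subtrees, the one of larger rank on the left. -/
def join (key : ℝ) (idx : Fin n) (a b : BpQueue n) : Timed (BpQueue n) := do
  let ra ← op a.rank
  let rb ← op b.rank
  if ← le rb ra then do
    let r ← op (rb + 1)
    op (node r key idx a b)
  else do
    let r ← op (ra + 1)
    op (node r key idx b a)

noncomputable def merge : BpQueue n → BpQueue n → Timed (BpQueue n)
  | nil, h => op h
  | node r k i a b, nil => op (node r k i a b)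
  | node r₁ k₁ i₁ a₁ b₁, node r₂ k₂ i₂ a₂ b₂ => do
    tick 1
    if ← le k₁ k₂ then do
      let c ← merge b₁ (node r₂ k₂ i₂ a₂ b₂)
      join k₁ i₁ a₁ c
    else do
      let c ← merge (node r₁ k₁ i₁ a₁ b₁) b₂
      join k₂ i₂ a₂ c
termination_by h₁ h₂ => sizeOf h₁ + sizeOf h₂

noncomputable def insert (key : ℝ) (idx : Fin n) (h : BpQueue n) : Timed (BpQueue n) := do
  let s ← op (node 1 key idx nil nil)
  merge s h

/-- Remove the smallest entry. -/
noncomputable def popMin : BpQueue n → Timed (BpQueue n)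
  | nil => op nil
  | node _ _ _ a b => merge a b

/-- The smallest entry. -/
def peek : BpQueue n → Timed (Option (ℝ × Fin n))
  | nil => op none
  | node _ k i _ _ => op (some (k, i))

end BpQueue

/-! ## The algorithm -/

namespace RapDibc

open Timed

variable {n m : ℕ}

/-- One evaluation of the cost function. -/
def evalPhi (P : RapDibc n m) (flops : ℕ) (x : ℝ) : Timed ℝ := ⟨P.φ x, flops⟩

/-- Put `c` in front of every list. -/
def consAll (c : Fin m) : List (List (Fin m)) → Timed (List (List (Fin m)))
  | [] => op []
  | t :: ts => do
    let r ← consAll c ts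
    op ((c :: t) :: r)

/-- Concatenation. -/
def appendT : List (List (Fin m)) → List (List (Fin m)) → Timed (List (List (Fin m)))
  | [], ys => op ys
  | x :: xs, ys => do
    let r ← appendT xs ys
    op (x :: r)

/-- All sequences of length `k` over the list `cs` of intervals (in increasing order) that
are non-decreasing. -/
def monotoneSeqs : ℕ → List (Fin m) → Timed (List (List (Fin m)))
  | 0, _ => op [[]]
  | _ + 1, [] => op []
  | k + 1, c :: cs => do
    let xs ← monotoneSeqs k (c :: cs)
    let xs' ← consAll c xs
    let ys ← monotoneSeqs (k + 1) cs
    appendT xs' ys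
termination_by k cs => k + cs.length

/-- The set `𝒦'` of the subpartition vectors `K' = (K₁ ≤ … ≤ K_{m-2})` with entries in `{0, …, n}`.
The vector `K'` is stored as the non-decreasing sequence of the intervals to which the partition
vector `(K', K_{m-2})` assigns the activities; so exactly the last but one interval is not used. -/
def subpartitions (P : RapDibc n m) : Timed (List (List (Fin m))) := do
  tick m
  monotoneSeqs n ((List.finRange m).filter (fun j => j ≠ P.penult))

/-- The data of the breakpoint search for a partition vector `K`: the queues `𝒜` and `ℬ`
of lower and upper breakpoints (which may also hold outdated ones), the intervals
`j i = j^K(i)`, and the bookkeeping parameters `B`, `F`, `N_F`, `V_B`. -/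
structure SearchState (n m : ℕ) where
  qA : BpQueue n
  qB : BpQueue n
  j : Fin n → Fin m
  B : ℝ
  F : ℝ
  NF : ℝ
  VB : ℝ

/-- The lower bound on activity `i` in its current interval. -/
def lower (P : RapDibc n m) (j : Fin n → Fin m) (i : Fin n) : Timed ℝ := do
  let c ← op (j i)
  op (P.l i c)

/-- The upper bound on activity `i` in its current interval. -/
def upper (P : RapDibc n m) (j : Fin n → Fin m) (i : Fin n) : Timed ℝ := do
  let c ← op (j i)
  op (P.u i c)

/-- The current lower breakpoint `α_i`. -/
noncomputable def alpha (P : RapDibc n m) (j : Fin n → Fin m) (i : Fin n) : Timed ℝ := do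
  let x ← P.lower j i
  let y ← op (P.b i)
  add x y

/-- The current upper breakpoint `β_i`. -/
noncomputable def beta (P : RapDibc n m) (j : Fin n → Fin m) (i : Fin n) : Timed ℝ := do
  let x ← P.upper j i
  let y ← op (P.b i)
  add x y

/-- Set up the breakpoint search from scratch: enter the listed activities with their intervals. -/
noncomputable def setUp (P : RapDibc n m) (flops : ℕ) :
    List (Fin n) → List (Fin m) → SearchState n m → Timed (SearchState n m)
  | i :: is, c :: cs, s => do
    tick 1
    let j ← write s.j i c
    let l ← P.lower j i
    let α ← P.alpha j i
    let β ← P.beta j i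
    let qA ← s.qA.insert α i
    let qB ← s.qB.insert β i
    let B ← add s.B l
    let v ← P.evalPhi flops α
    let VB ← add s.VB v
    P.setUp flops is cs { s with qA := qA, qB := qB, j := j, B := B, VB := VB }
  | _, _, s => pure s

/-- The smallest element of `𝒜 ∪ ℬ`, with the tag `true` if it is in `𝒜`. -/
noncomputable def minBreakpoint (qA qB : BpQueue n) : Timed (Option (Bool × ℝ × Fin n)) := do
  let a ← qA.peek
  let b ← qB.peek
  match a, b with
  | none, none => op none
  | some e, none => op (some (true, e))
  | none, some e => op (some (false, e))
  | some e, some e' => do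
    if ← le e.1 e'.1 then op (some (true, e)) else op (some (false, e'))

/-- One iteration of the breakpoint search for `K`.  It either delivers the optimal multiplier
`λ^K` and the optimal value `V^K` of the subproblem, or it removes one breakpoint.
If the subproblem is infeasible, then `V^K = ⊤`, and `λ^K` is `⊥` or `⊤`, according as the
lower bounds have a sum above `R` or the upper bounds have a sum below `R`. -/
noncomputable def searchStep (P : RapDibc n m) (flops : ℕ) (s : SearchState n m) :
    Timed (SearchState n m × Option (EReal × EReal)) := do
  let bp ← minBreakpoint s.qA s.qB
  match bp with
  | none => pure (s, some (⊤, ⊤))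
  | some (isLower, lam, i) => do
    let α ← P.alpha s.j i
    let β ← P.beta s.j i
    if ← eq lam (if isLower then α else β) then do
      let t ← mul s.NF lam
      let t ← add s.B t
      let z ← sub t s.F
      if ← eq z P.R then do
        let v ← P.evalPhi flops lam
        let v ← mul s.NF v
        let V ← add s.VB v
        pure (s, some ((lam : EReal), (V : EReal)))
      else if ← lt P.R z then do
        if ← eq s.NF 0 then
          pure (s, some (⊥, ⊤))
        else do
          let t ← sub P.R s.B
          let t ← add t s.F
          let lamK ← div t s.NF
          let v ← P.evalPhi flops lamK
          let v ← mul s.NF v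
          let V ← add s.VB v
          pure (s, some ((lamK : EReal), (V : EReal)))
      else if isLower then do
        let l ← P.lower s.j i
        let b ← op (P.b i)
        let B ← sub s.B l
        let F ← add s.F b
        let NF ← add s.NF 1
        let v ← P.evalPhi flops α
        let VB ← sub s.VB v
        let qA ← s.qA.popMin
        pure ({ s with qA := qA, B := B, F := F, NF := NF, VB := VB }, none)
      else do
        let u ← P.upper s.j i
        let b ← op (P.b i)
        let B ← add s.B u
        let F ← sub s.F b
        let NF ← sub s.NF 1
        let v ← P.evalPhi flops β
        let VB ← add s.VB v
        let qB ← s.qB.popMin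
        pure ({ s with qB := qB, B := B, F := F, NF := NF, VB := VB }, none)
    else if isLower then do
      -- an outdated lower breakpoint
      let qA ← s.qA.popMin
      pure ({ s with qA := qA }, none)
    else do
      -- an outdated upper breakpoint
      let qB ← s.qB.popMin
      pure ({ s with qB := qB }, none)

/-- The breakpoint search for the current partition vector.  At most `4 n` breakpoints are ever
stored for one subpartition vector, and every iteration but the last one removes one. -/
noncomputable def search (P : RapDibc n m) (flops : ℕ) (s : SearchState n m) :
    Timed (SearchState n m × Option (EReal × EReal)) :=
  repeatUntil (P.searchStep flops) (4 * n + 1) s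

/-- First update round: remove the contribution of activity `i` in its old interval.  The
breakpoints that have been removed from the queues so far are those below `λ^K`.  Those of
activity `i` that are still in the queues become outdated and are removed later. -/
noncomputable def removeOld (P : RapDibc n m) (flops : ℕ) (lam : EReal) (i : Fin n)
    (s : SearchState n m) : Timed (SearchState n m) := do
  let b ← op (P.b i)
  let α ← P.alpha s.j i
  let β ← P.beta s.j i
  if ← le lam (α : EReal) then do
    let l ← P.lower s.j i
    let B ← sub s.B l
    let v ← P.evalPhi flops α
    let VB ← sub s.VB v
    pure { s with B := B, VB := VB }
  else if ← le lam (β : EReal) then do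
    let F ← sub s.F b
    let NF ← sub s.NF 1
    pure { s with F := F, NF := NF }
  else do
    let u ← P.upper s.j i
    let B ← sub s.B u
    let v ← P.evalPhi flops β
    let VB ← sub s.VB v
    pure { s with B := B, VB := VB }

/-- Second update round: add the contribution of activity `i` in its new interval. -/
noncomputable def addNew (P : RapDibc n m) (flops : ℕ) (lam : EReal) (i : Fin n)
    (s : SearchState n m) : Timed (SearchState n m) := do
  let b ← op (P.b i)
  let α ← P.alpha s.j i
  let β ← P.beta s.j i
  if ← lt lam (α : EReal) then do
    let l ← P.lower s.j i
    let B ← add s.B l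
    let v ← P.evalPhi flops α
    let VB ← add s.VB v
    let qA ← s.qA.insert α i
    let qB ← s.qB.insert β i
    pure { s with qA := qA, qB := qB, B := B, VB := VB }
  else if ← lt lam (β : EReal) then do
    let F ← add s.F b
    let NF ← add s.NF 1
    let qB ← s.qB.insert β i
    pure { s with qB := qB, F := F, NF := NF }
  else do
    let u ← P.upper s.j i
    let B ← add s.B u
    let v ← P.evalPhi flops β
    let VB ← add s.VB v
    pure { s with B := B, VB := VB }

/-- The best partition vector `K = (K', K_{m-1})` so far, with `λ^K` and `V^K`. -/
structure Candidate (m : ℕ) where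
  V : EReal
  lam : EReal
  sub : List (Fin m)
  K : ℕ

/-- Solve the subproblems for `(K', K), (K', K + 1), …, (K', n)` in one run of the breakpoint
search; `rest` lists the activities that are still in the last interval. -/
noncomputable def sweep (P : RapDibc n m) (flops : ℕ) (sub : List (Fin m)) :
    (rest : List (Fin n)) → (K : ℕ) → SearchState n m → Candidate m → Timed (Candidate m)
  | rest, K, s, best => do
    tick 1
    let p ← P.search flops s
    let r := p.2.getD (⊤, ⊤)
    let better ← lt r.2 best.V
    let best' ← op (if better then { V := r.2, lam := r.1, sub := sub, K := K } else best)
    match rest with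
    | [] => pure best'
    | i :: rest' => do
      let s₁ ← P.removeOld flops r.1 i p.1
      let j ← write s₁.j i P.penult
      let s₂ ← P.addNew flops r.1 i { s₁ with j := j }
      let K' ← op (K + 1)
      P.sweep flops sub rest' K' s₂ best'

/-- The number `K_{m-2}` of activities outside of the last interval. -/
def countSub (P : RapDibc n m) : List (Fin m) → Timed ℕ
  | [] => op 0
  | c :: cs => do
    let k ← P.countSub cs
    if ← eq c P.last then op k else op (k + 1)

/-- One iteration of the outer loop, for the subpartition vector `sub`. -/
noncomputable def processSub (P : RapDibc n m) (flops : ℕ) (sub : List (Fin m))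
    (best : Candidate m) : Timed (Candidate m) := do
  tick n
  let s ← P.setUp flops (List.finRange n) sub
    { qA := .nil, qB := .nil, j := fun _ => P.last, B := 0, F := 0, NF := 0, VB := 0 }
  let K ← P.countSub sub
  tick n
  P.sweep flops sub ((List.finRange n).drop K) K s best

/-- The outer loop. -/
noncomputable def processAll (P : RapDibc n m) (flops : ℕ) :
    List (List (Fin m)) → Candidate m → Timed (Candidate m)
  | [], best => pure best
  | sub :: subs, best => do
    tick 1
    let best' ← P.processSub flops sub best
    P.processAll flops subs best'

/-- Compute `x(K, λ)` for the partition vector `(K', K)`, one activity after the other. -/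
noncomputable def reconstruct (P : RapDibc n m) (lam : ℝ) (K : ℕ) :
    List (Fin n) → List (Fin m) → (Fin n → ℝ) → Timed (Fin n → ℝ)
  | i :: is, c :: cs, x => do
    tick 1
    let isLast ← eq c P.last
    let moved ← lt (i : ℕ) K
    let c' ← op (if isLast && moved then P.penult else c)
    let l ← op (P.l i c')
    let u ← op (P.u i c')
    let b ← op (P.b i)
    let α ← add l b
    let β ← add u b
    let t ← sub lam b
    let low ← le lam α
    let high ← le β lam
    let x' ← write x i (if low then l else if high then u else t)
    P.reconstruct lam K is cs x'
  | _, _, x => pure x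

/-- The refined algorithm for RAP-DIBC. -/
noncomputable def refinedAlgorithm (P : RapDibc n m) (flops : ℕ) :
    Timed (Option (Fin n → ℝ)) := do
  let subs ← P.subpartitions
  let best ← P.processAll flops subs { V := ⊤, lam := ⊤, sub := [], K := 0 }
  if ← eq best.V ⊤ then
    pure none
  else do
    tick n
    let x ← P.reconstruct best.lam.toReal best.K (List.finRange n) best.sub (fun _ => 0)
    pure (some x)

end RapDibc

/-! Some optimal solution uses a non-decreasing assignment of intervals to activities, so partition
vectors suffice. Suppose s < t are inverted, with values v > w. `exists_exchange` replaces them by z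
and v + w - z with w ≤ z < v. Either the two values are swapped, or an individual outer interval end
forbids the swap. In that case s goes to its first interval or t to its last one. This interval is
at least as long as every gap, so sliding within it lets the partner meet an admitted interval.
Since b is non-increasing, the new shifted pair lies between the old shifted values, and convexity
shows that the cost does not grow. `exists_monotone_assignment` avoids iterating exchanges: on the
compact set of solutions that are no worse than a given one, it minimizes ∑ (x_i - i)², which every
exchange strictly decreases.

For a fixed assignment, clamping one common multiplier to all shifted intervals is optimal once the
sum is R: a single subgradient of φ at the multiplier supports φ at the clamped point on each
interval (`exists_slope_at_clamp`, `objective_nearest_le`). The sum of the clamped points is a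
non-decreasing, piecewise affine function of the multiplier, and the bookkeeping numbers are its
coefficients on the current piece. `Consistent` ties queues and numbers to a status of each
activity, `Searching` says that the multiplier has not been reached, and `Stopped` describes the
state at delivery. Infeasible subproblems get the multipliers ⊥ and ⊤. Moving an activity from the
last interval to the one before it strictly lowers the sum at every multiplier, so the next
multiplier cannot lie below the present one and the search may go on from there (`move_spec`).

The running time is amortized. A move inserts at most two breakpoints, and every iteration of a
search except its last removes one. Hence one subpartition vector needs O(n) queue operations and
evaluations of φ. Leftist heaps make each queue operation logarithmic, and the subpartition vectors
are multisets counted by the binomial coefficient. -/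

namespace Timed

/-! ### Values and costs of timed computations -/

@[simp] theorem val_bind {α β : Type} (x : Timed α) (f : α → Timed β) :
    (x >>= f).val = (f x.val).val := rfl

@[simp] theorem time_bind {α β : Type} (x : Timed α) (f : α → Timed β) :
    (x >>= f).time = x.time + (f x.val).time := rfl

@[simp] theorem val_pure {α : Type} (a : α) : (pure a : Timed α).val = a := rfl

@[simp] theorem time_pure {α : Type} (a : α) : (pure a : Timed α).time = 0 := rfl

@[simp] theorem val_op {α : Type} (a : α) : (op a).val = a := rfl

@[simp] theorem time_op {α : Type} (a : α) : (op a).time = 1 := rfl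

@[simp] theorem val_tick (k : ℕ) : (tick k).val = () := rfl

@[simp] theorem time_tick (k : ℕ) : (tick k).time = k := rfl

theorem time_ite {α : Type} (c : Prop) [Decidable c] (x y : Timed α) :
    (if c then x else y).time = if c then x.time else y.time := apply_ite _ _ _ _

attribute [simp] Timed.add Timed.sub Timed.mul Timed.div Timed.le Timed.lt Timed.eq Timed.write

end Timed

/-! ### Leftist heaps: contents, validity and logarithmic cost -/

namespace BpQueue

open Timed

variable {n : ℕ}

/-- The multiset of the entries of a queue. -/
def entries : BpQueue n → Multiset (ℝ × Fin n)
  | nil => 0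
  | node _ k i a b => (k, i) ::ₘ (a.entries + b.entries)

/-- The heap order, the leftist property and the correctness of the stored ranks. -/
def Valid : BpQueue n → Prop
  | nil => True
  | node r k _ a b => a.Valid ∧ b.Valid ∧ b.rank ≤ a.rank ∧ r = b.rank + 1 ∧
      ∀ e ∈ a.entries + b.entries, k ≤ e.1

@[simp] theorem entries_nil : (nil : BpQueue n).entries = 0 := rfl

@[simp] theorem rank_nil : (nil : BpQueue n).rank = 0 := rfl

@[simp] theorem rank_node (r : ℕ) (k : ℝ) (i : Fin n) (a b : BpQueue n) :
    (node r k i a b).rank = r := rfl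

theorem valid_nil : (nil : BpQueue n).Valid := trivial

/-- By the leftist property both subtrees have at least the rank of the right one, so each further
unit of rank doubles the guaranteed size. -/
theorem two_pow_rank_le {h : BpQueue n} (hv : h.Valid) : 2 ^ h.rank ≤ h.entries.card + 1 := by
  induction h with
  | nil => simp
  | node r k i a b iha ihb =>
    obtain ⟨ha, hb, hab, hr, -⟩ := hv
    have h1 := iha ha
    have h2 := ihb hb
    have h3 : 2 ^ b.rank ≤ 2 ^ a.rank := Nat.pow_le_pow_right (by norm_num) hab
    simp only [rank_node, entries, Multiset.card_cons, Multiset.card_add, hr, pow_succ]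
    omega

theorem rank_le_log {h : BpQueue n} (hv : h.Valid) {N : ℕ} (hN : h.entries.card ≤ N) :
    h.rank ≤ Nat.log 2 (N + 1) :=
  Nat.le_log_of_pow_le (by norm_num) ((two_pow_rank_le hv).trans (by omega))

theorem entries_join (k : ℝ) (i : Fin n) (a b : BpQueue n) :
    (join k i a b).val.entries = (k, i) ::ₘ (a.entries + b.entries) := by
  by_cases h : b.rank ≤ a.rank
  · simp [join, h, entries]
  · simp [join, h, entries, add_comm]

theorem time_join (k : ℝ) (i : Fin n) (a b : BpQueue n) : (join k i a b).time = 5 := by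
  by_cases h : b.rank ≤ a.rank <;> simp [join, h]

theorem Valid.join {k : ℝ} {i : Fin n} {a b : BpQueue n} (ha : a.Valid) (hb : b.Valid)
    (hk : ∀ e ∈ a.entries + b.entries, k ≤ e.1) : (join k i a b).val.Valid := by
  by_cases h : b.rank ≤ a.rank
  · simp only [BpQueue.join, val_bind, val_op, Timed.le, h]
    exact ⟨ha, hb, h, rfl, hk⟩
  · simp only [BpQueue.join, val_bind, val_op, Timed.le, h]
    exact ⟨hb, ha, by omega, rfl, by rwa [add_comm]⟩

theorem entries_merge (h₁ h₂ : BpQueue n) :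
    (merge h₁ h₂).val.entries = h₁.entries + h₂.entries := by
  fun_induction merge h₁ h₂ with
  | case1 h => simp
  | case2 r k i a b => simp
  | case3 r₁ k₁ i₁ a₁ b₁ r₂ k₂ i₂ a₂ b₂ ih1 ih2 =>
    by_cases h : k₁ ≤ k₂
    · simp only [val_bind, Timed.le, val_op, h, decide_true, if_true, entries_join, ih1]
      simp only [entries, Multiset.cons_add, add_assoc]
    · simp only [val_bind, Timed.le, val_op, h, decide_false, entries_join, ih2, if_false,
        Bool.false_eq_true]
      simp only [entries, Multiset.cons_add, Multiset.add_cons]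
      ac_rfl

theorem Valid.merge {h₁ h₂ : BpQueue n} (hv₁ : h₁.Valid) (hv₂ : h₂.Valid) :
    (merge h₁ h₂).val.Valid := by
  fun_induction BpQueue.merge h₁ h₂ with
  | case1 h => exact hv₂
  | case2 r k i a b => exact hv₁
  | case3 r₁ k₁ i₁ a₁ b₁ r₂ k₂ i₂ a₂ b₂ ih1 ih2 =>
    obtain ⟨ha₁, hb₁, -, -, hk₁⟩ := id hv₁
    obtain ⟨ha₂, hb₂, -, -, hk₂⟩ := id hv₂
    by_cases h : k₁ ≤ k₂
    · simp only [val_bind, Timed.le, val_op, h, decide_true, if_true]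
      refine Valid.join ha₁ (ih1 hb₁ hv₂) fun e he => ?_
      rw [entries_merge] at he
      simp only [entries, Multiset.mem_add, Multiset.mem_cons] at he hk₁ hk₂
      rcases he with he | he | rfl | he
      · exact hk₁ e (.inl he)
      · exact hk₁ e (.inr he)
      · exact h
      · exact h.trans (hk₂ e he)
    · simp only [val_bind, Timed.le, val_op, h, decide_false, if_false, Bool.false_eq_true]
      refine Valid.join ha₂ (ih2 hv₁ hb₂) fun e he => ?_
      rw [entries_merge] at he
      simp only [entries, Multiset.mem_add, Multiset.mem_cons] at he hk₁ hk₂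
      rcases he with he | (rfl | he) | he
      · exact hk₂ e (.inl he)
      · exact (not_le.mp h).le
      · exact (not_le.mp h).le.trans (hk₁ e he)
      · exact hk₂ e (.inr he)

/-- Each recursive call replaces one of the two heaps by its right subtree, whose rank is smaller by
one. The call itself costs 7: the tick, the comparison and 5 for `join`. -/
theorem time_merge_le {h₁ h₂ : BpQueue n} (hv₁ : h₁.Valid) (hv₂ : h₂.Valid) :
    (merge h₁ h₂).time ≤ 7 * (h₁.rank + h₂.rank) + 1 := by
  fun_induction BpQueue.merge h₁ h₂ with
  | case1 h => simp
  | case2 r k i a b => simp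
  | case3 r₁ k₁ i₁ a₁ b₁ r₂ k₂ i₂ a₂ b₂ ih1 ih2 =>
    obtain ⟨-, hb₁, -, hr₁, -⟩ := id hv₁
    obtain ⟨-, hb₂, -, hr₂, -⟩ := id hv₂
    by_cases h : k₁ ≤ k₂
    · have := ih1 hb₁ hv₂
      simp only [time_bind, Timed.le, val_op, time_op, time_tick, h, decide_true, if_true,
        time_join]
      simp only [rank_node] at this ⊢
      omega
    · have := ih2 hv₁ hb₂
      simp only [time_bind, Timed.le, val_op, time_op, time_tick, h, decide_false,
        time_join, if_false, Bool.false_eq_true]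
      simp only [rank_node] at this ⊢
      omega

theorem entries_insert (k : ℝ) (i : Fin n) (h : BpQueue n) :
    (h.insert k i).val.entries = (k, i) ::ₘ h.entries := by
  simp [BpQueue.insert, entries_merge, entries]

theorem valid_singleton (k : ℝ) (i : Fin n) : (node 1 k i nil nil).Valid := by
  simp [Valid]

theorem Valid.insert {h : BpQueue n} (hv : h.Valid) (k : ℝ) (i : Fin n) :
    (h.insert k i).val.Valid := (valid_singleton k i).merge hv

theorem time_insert_le {h : BpQueue n} (hv : h.Valid) (k : ℝ) (i : Fin n) {N : ℕ}
    (hN : h.entries.card ≤ N) : (h.insert k i).time ≤ 7 * Nat.log 2 (N + 1) + 9 := by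
  have h1 := time_merge_le (valid_singleton k i) hv
  have h2 := rank_le_log hv hN
  simp only [BpQueue.insert, time_bind, time_op, val_op]
  simp only [rank_node] at h1
  omega

theorem exists_entries_popMin {h : BpQueue n} {e : ℝ × Fin n} (hp : h.peek.val = some e) :
    h.entries = e ::ₘ h.popMin.val.entries := by
  cases h with
  | nil => simp [peek] at hp
  | node r k i a b =>
    simp only [peek, val_op, Option.some.injEq] at hp
    subst hp
    simp [popMin, entries_merge, entries]

theorem Valid.popMin {h : BpQueue n} (hv : h.Valid) : h.popMin.val.Valid := by
  cases h with
  | nil => exact hv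
  | node r k i a b => exact Valid.merge hv.1 hv.2.1

theorem time_popMin_le {h : BpQueue n} (hv : h.Valid) {N : ℕ}
    (hN : h.entries.card ≤ N) : h.popMin.time ≤ 14 * Nat.log 2 (N + 1) + 1 := by
  cases h with
  | nil => simp [BpQueue.popMin]
  | node r k i a b =>
    obtain ⟨ha, hb, -, -, -⟩ := hv
    simp only [entries, Multiset.card_cons, Multiset.card_add] at hN
    have h1 := time_merge_le ha hb
    have h2 := rank_le_log ha (N := N) (by omega)
    have h3 := rank_le_log hb (N := N) (by omega)
    simp only [BpQueue.popMin]
    omega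

@[simp] theorem time_peek (h : BpQueue n) : h.peek.time = 1 := by
  cases h <;> rfl

theorem Valid.le_of_peek {h : BpQueue n} (hv : h.Valid) {e : ℝ × Fin n}
    (hp : h.peek.val = some e) {e' : ℝ × Fin n} (he' : e' ∈ h.entries) : e.1 ≤ e'.1 := by
  cases h with
  | nil => simp [peek] at hp
  | node r k i a b =>
    simp only [peek, val_op, Option.some.injEq] at hp
    subst hp
    simp only [entries, Multiset.mem_cons] at he'
    rcases he' with rfl | he'
    · exact le_rfl
    · exact hv.2.2.2.2 e' he'

theorem entries_of_peek_eq_none {h : BpQueue n} (hp : h.peek.val = none) : h.entries = 0 := by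
  cases h with
  | nil => rfl
  | node r k i a b => simp [peek] at hp

end BpQueue

/-! ### Convexity on the real line -/

/-- The right derivative serves as the slope: it is at most all slopes to the right, and at least
the left derivative, which bounds all slopes to the left. -/
theorem ConvexOn.exists_subgradient {φ : ℝ → ℝ} (hφ : ConvexOn ℝ Set.univ φ) (c : ℝ) :
    ∃ g, ∀ y, φ c + g * (y - c) ≤ φ y := by
  have hc : c ∈ interior (Set.univ : Set ℝ) := by simp
  refine ⟨derivWithin φ (Set.Ioi c) c, fun y => ?_⟩
  rcases lt_trichotomy y c with h | rfl | h
  · have h1 := hφ.slope_le_leftDeriv_of_mem_interior (Set.mem_univ y) hc h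
    have h2 := hφ.leftDeriv_le_rightDeriv_of_mem_interior hc
    have h3 := h1.trans h2
    rw [slope_def_field, div_le_iff₀ (by linarith)] at h3
    linarith
  · simp
  · have h1 := hφ.rightDeriv_le_slope_of_mem_interior hc (Set.mem_univ y) h
    rw [slope_def_field, le_div_iff₀ (by linarith)] at h1
    linarith

/-- The subgradient at c also works at the clamped points, because slopes increase: past a ≥ c they
are at least g, and before d ≤ c at most g. The point is that g is chosen before the interval, so
that it can act as a common Lagrange multiplier. -/
theorem ConvexOn.exists_slope_at_clamp {φ : ℝ → ℝ} (hφ : ConvexOn ℝ Set.univ φ) (c : ℝ) :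
    ∃ g, ∀ a d y, a ≤ y → y ≤ d →
      φ (if c ≤ a then a else if d ≤ c then d else c) +
        g * (y - if c ≤ a then a else if d ≤ c then d else c) ≤ φ y := by
  obtain ⟨g, hg⟩ := hφ.exists_subgradient c
  refine ⟨g, fun a d y hay hyd => ?_⟩
  split_ifs with h1 h2
  · rcases hay.eq_or_lt with rfl | hay
    · simp
    rcases h1.eq_or_lt with rfl | h1
    · exact hg y
    have h := hφ.slope_mono_adjacent (Set.mem_univ c) (Set.mem_univ y) h1 hay
    have h3 : g ≤ (φ a - φ c) / (a - c) := by
      rw [le_div_iff₀ (by linarith)]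
      linarith [hg a]
    have h4 := h3.trans h
    rw [le_div_iff₀ (by linarith)] at h4
    linarith
  · rcases hyd.eq_or_lt with rfl | hyd
    · simp
    rcases h2.eq_or_lt with rfl | h2
    · exact hg y
    have h := hφ.slope_mono_adjacent (Set.mem_univ y) (Set.mem_univ c) hyd h2
    have h3 : (φ c - φ d) / (c - d) ≤ g := by
      rw [div_le_iff₀ (by linarith)]
      linarith [hg d]
    have h4 := h.trans h3
    rw [div_le_iff₀ (by linarith)] at h4
    linarith
  · exact hg y

/-- A pair with a given sum has a smaller total cost than a pair that is further apart. -/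
theorem ConvexOn.add_le_add_of_between {φ : ℝ → ℝ} (hφ : ConvexOn ℝ Set.univ φ) {a d p q : ℝ}
    (hap : a ≤ p) (hpd : p ≤ d) (hs : p + q = a + d) : φ p + φ q ≤ φ a + φ d := by
  rcases hap.eq_or_lt with rfl | hap
  · rw [show q = d by linarith]
  rcases hpd.eq_or_lt with rfl | hpd
  · rw [show q = a by linarith, add_comm]
  have had : 0 < d - a := by linarith
  have hw : (d - p) / (d - a) + (p - a) / (d - a) = 1 := by field_simp; ring
  have h0 : 0 ≤ (d - p) / (d - a) := div_nonneg (by linarith) had.le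
  have h1 : 0 ≤ (p - a) / (d - a) := div_nonneg (by linarith) had.le
  have hp := hφ.2 (Set.mem_univ a) (Set.mem_univ d) h0 h1 hw
  have hq := hφ.2 (Set.mem_univ a) (Set.mem_univ d) h1 h0 ((add_comm _ _).trans hw)
  simp only [smul_eq_mul] at hp hq
  have ep : (d - p) / (d - a) * a + (p - a) / (d - a) * d = p := by field_simp; ring
  have eq' : (p - a) / (d - a) * a + (d - p) / (d - a) * d = q := by
    rw [show q = a + d - p by linarith]; field_simp; ring
  rw [ep] at hp
  rw [eq'] at hq
  have e : ∀ t : ℝ, (d - p) / (d - a) * t + (p - a) / (d - a) * t = t := fun t => by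
    rw [← add_mul, hw, one_mul]
  linarith [e (φ a), e (φ d)]

theorem Fintype.sum_eq_sub_add {ι : Type*} [Fintype ι] (i : ι) {f g : ι → ℝ}
    (h : ∀ k, k ≠ i → f k = g k) : ∑ k, g k = ∑ k, f k - f i + g i := by
  classical
  rw [← Finset.add_sum_erase _ f (Finset.mem_univ i), ← Finset.add_sum_erase _ g (Finset.mem_univ i),
    Finset.sum_congr rfl fun k hk => h k (Finset.ne_of_mem_erase hk)]
  ring

/-! ### The exchange argument: non-decreasing assignments suffice -/

namespace RapDibc

open Timed

variable {n m : ℕ}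

/-- The set of the values that are admitted for activity `i`. -/
def Allowed (P : RapDibc n m) (i : Fin n) : Set ℝ := ⋃ j, Set.Icc (P.l i j) (P.u i j)

theorem mem_allowed {P : RapDibc n m} {i : Fin n} {v : ℝ} :
    v ∈ P.Allowed i ↔ ∃ j, v ∈ Set.Icc (P.l i j) (P.u i j) := Set.mem_iUnion

theorem first_le (P : RapDibc n m) (j : Fin m) : P.first ≤ j := Nat.zero_le _

theorem le_last (P : RapDibc n m) (j : Fin m) : j ≤ P.last := by
  have := j.2
  rw [Fin.le_def]
  simp only [last]
  omega

theorem u_lt_u (P : RapDibc n m) (i : Fin n) {j j' : Fin m} (h : j < j') : P.u i j < P.u i j' :=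
  (P.u_lt_l i j j' h).trans_le (P.l_le_u i j')

theorem l_lt_l (P : RapDibc n m) (i : Fin n) {j j' : Fin m} (h : j < j') : P.l i j < P.l i j' :=
  (P.l_le_u i j).trans_lt (P.u_lt_l i j j' h)

theorem l_first_le (P : RapDibc n m) (i : Fin n) (j : Fin m) : P.l i P.first ≤ P.l i j := by
  rcases (P.first_le j).eq_or_lt with h | h
  · rw [h]
  · exact (P.l_lt_l i h).le

theorem u_le_last (P : RapDibc n m) (i : Fin n) (j : Fin m) : P.u i j ≤ P.u i P.last := by
  rcases (P.le_last j).eq_or_lt with h | h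
  · rw [h]
  · exact (P.u_lt_u i h).le

theorem u_eq_of_lt (P : RapDibc n m) (i i' : Fin n) {j j' : Fin m} (h : j < j') :
    P.u i j = P.u i' j := P.u_common i i' j (by have := j'.2; have : (j : ℕ) < j' := h; omega)

theorem l_eq_of_lt (P : RapDibc n m) (i i' : Fin n) {j j' : Fin m} (h : j' < j) :
    P.l i j = P.l i' j := P.l_common i i' j (by have : (j' : ℕ) < j := h; omega)

/-- An interval that starts between the extreme admitted values and is at least as long as the
gaps contains an admitted value. -/
theorem exists_allowed_mem_Icc (P : RapDibc n m) {i : Fin n} {d p q : ℝ} (hgap : P.GapsLE d)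
    (hlp : P.l i P.first ≤ p) (hpu : p ≤ P.u i P.last) (hpq : d ≤ q - p) (hle : p ≤ q) :
    ∃ w ∈ P.Allowed i, p ≤ w ∧ w ≤ q := by
  have hne : (Finset.univ.filter fun j => P.l i j ≤ p).Nonempty := ⟨P.first, by simpa using hlp⟩
  -- The last interval that starts at or before p either contains p, or ends before p; then the next
  -- one starts in (p, q], since the gap is at most d.
  obtain ⟨j, hj, hmax⟩ := Finset.exists_max_image _ id hne
  simp only [Finset.mem_filter, Finset.mem_univ, true_and, id] at hj hmax
  by_cases h : p ≤ P.u i j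
  · exact ⟨p, mem_allowed.2 ⟨j, hj, h⟩, le_rfl, hle⟩
  push Not at h
  have hlast : j ≠ P.last := by
    rintro rfl
    linarith
  have hj1 : (j : ℕ) + 1 < m := by
    have h1 : (j : ℕ) < P.last := lt_of_le_of_ne (P.le_last j) fun h => hlast (Fin.ext h)
    have h2 := P.last.2
    omega
  have hlt : p < P.l i ⟨j + 1, hj1⟩ := by
    by_contra hc
    have := hmax _ (not_lt.mp hc)
    rw [Fin.le_def] at this
    simp at this
  have := hgap i j ⟨j + 1, hj1⟩ rfl
  exact ⟨_, mem_allowed.2 ⟨_, le_rfl, P.l_le_u i _⟩, hlt.le, by linarith⟩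

/-- Two activities in inverted order can be brought closer together. -/
theorem exists_exchange (P : RapDibc n m)
    (hc : (P.F1 ∧ P.L1) ∨ (P.F1 ∧ P.L2) ∨ (P.F2 ∧ P.L1) ∨ (P.F2 ∧ P.L2))
    {s t : Fin n} (hst : s < t) {a c : Fin m} (hca : c < a) {v w : ℝ}
    (hv : v ∈ Set.Icc (P.l s a) (P.u s a)) (hw : w ∈ Set.Icc (P.l t c) (P.u t c)) :
    ∃ z ∈ P.Allowed s, v + w - z ∈ P.Allowed t ∧ w ≤ z ∧ z < v := by
  have hF : P.F1 ∨ P.F2 := by tauto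
  have hL : P.L1 ∨ P.L2 := by tauto
  have hwv : w < v := by
    have h1 := P.u_lt_l s c a hca
    rw [P.u_eq_of_lt s t hca] at h1
    linarith [hw.2, hv.1]
  have hlow : P.l t P.first ≤ w := (P.l_first_le t c).trans hw.1
  have hhigh : v ≤ P.u s P.last := hv.2.trans (P.u_le_last s a)
  have hwf : P.l s P.first ≤ w ∨ (P.F2 ∧ w < P.l s P.first) := by
    rcases hF with h | h
    · exact .inl ((h s t hst).trans hlow)
    · rcases le_or_gt (P.l s P.first) w with h' | h'
      · exact .inl h'
      · exact .inr ⟨h, h'⟩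
  have hvl : v ≤ P.u t P.last ∨ (P.L2 ∧ P.u t P.last < v) := by
    rcases hL with h | h
    · exact .inl (hhigh.trans (h s t hst))
    · rcases le_or_gt v (P.u t P.last) with h' | h'
      · exact .inl h'
      · exact .inr ⟨h, h'⟩
  have hfu : P.u s P.first < v := by
    have := P.u_lt_l s P.first a ((P.first_le c).trans_lt hca)
    linarith [hv.1]
  have hll : w < P.l t P.last := by
    have := P.u_lt_l t c P.last (hca.trans_le (P.le_last a))
    linarith [hw.2]
  have hlu := P.l_le_u s P.first
  have hlu' := P.l_le_u t P.last
  -- Letting s range over its whole first interval makes the partner range over a window at least as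
  -- long as every gap. Its left end is not below the admitted values of t, since w is admitted and
  -- the first interval of s ends before v.
  have caseF : P.F2 → w < P.l s P.first → v + w - P.u s P.first ≤ P.u t P.last →
      ∃ z ∈ P.Allowed s, v + w - z ∈ P.Allowed t ∧ w ≤ z ∧ z < v := fun h2 hlt hle => by
    obtain ⟨r, hr, h3, h4⟩ := P.exists_allowed_mem_Icc (i := t) (p := v + w - P.u s P.first)
      (q := v + w - P.l s P.first) (h2 s) (by linarith) hle (by linarith) (by linarith)
    refine ⟨v + w - r, mem_allowed.2 ⟨P.first, by linarith, by linarith⟩, ?_, by linarith,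
      by linarith⟩
    simpa using hr
  -- The mirror image: t ranges over its last interval and s is found in the resulting window.
  have caseL : P.L2 → P.l s P.first ≤ v + w - P.u t P.last → P.u t P.last < v →
      ∃ z ∈ P.Allowed s, v + w - z ∈ P.Allowed t ∧ w ≤ z ∧ z < v := fun h2 hle hlt => by
    obtain ⟨z, hz, h3, h4⟩ := P.exists_allowed_mem_Icc (i := s) (p := v + w - P.u t P.last)
      (q := v + w - P.l t P.last) (h2 t) hle (by linarith) (by linarith) (by linarith)
    exact ⟨z, hz, mem_allowed.2 ⟨P.last, by linarith, by linarith⟩, by linarith, by linarith⟩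
  rcases hwf with h1 | ⟨h1, h1'⟩
  · rcases hvl with h2 | ⟨h2, h2'⟩
    -- A plain swap. All interval ends involved are common to s and t, except possibly the lower end
    -- of a first and the upper end of a last interval, which `h1` and `h2` cover.
    · refine ⟨w, mem_allowed.2 ⟨c, ?_, ?_⟩, mem_allowed.2 ⟨a, ?_, ?_⟩, le_rfl, hwv⟩
      · rcases (P.first_le c).eq_or_lt with h | h
        · rwa [← h]
        · rw [P.l_eq_of_lt s t h]; exact hw.1
      · rw [P.u_eq_of_lt s t hca]; exact hw.2
      · rw [P.l_eq_of_lt t s hca]; linarith [hv.1]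
      · rcases (P.le_last a).eq_or_lt with h | h
        · rw [h]; linarith
        · rw [P.u_eq_of_lt t s h]; linarith [hv.2]
    · exact caseL h2 (by linarith) h2'
  · rcases le_or_gt (v + w - P.u s P.first) (P.u t P.last) with h3 | h3
    · exact caseF h1 h1' h3
    -- If the window of `caseF` starts above all admitted values of t, then v exceeds them too, and
    -- the same inequality places the window of `caseL` above the lowest value of s.
    · rcases hvl with h2 | ⟨h2, h2'⟩
      · exact caseF h1 h1' (by linarith)
      · exact caseL h2 (by linarith) h2'

/-- `x` solves the subproblem of the assignment `a` of intervals to activities. -/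
def FeasibleFor (P : RapDibc n m) (a : Fin n → Fin m) (x : Fin n → ℝ) : Prop :=
  ∑ i, x i = P.R ∧ ∀ i, x i ∈ Set.Icc (P.l i (a i)) (P.u i (a i))

theorem sum_update_update {s t : Fin n} (hst : s ≠ t) (f : Fin n → ℝ → ℝ) (x : Fin n → ℝ)
    (p q : ℝ) : ∑ i, f i (Function.update (Function.update x s p) t q i) =
      ∑ i, f i (x i) - f s (x s) - f t (x t) + f s p + f t q := by
  rw [Fintype.sum_eq_sub_add t (f := fun i => f i (Function.update x s p i)),
    Fintype.sum_eq_sub_add s (f := fun i => f i (x i)) (g := fun i => f i (Function.update x s p i))]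
  · simp [hst.symm]
    ring
  · intro k hk
    simp [hk]
  · intro k hk
    simp [hk]

/-- An extremal choice replaces repeated exchanges: among the solutions that are no worse than y,
one minimizing a suitable potential admits no inverted pair. -/
theorem exists_monotone_assignment (P : RapDibc n m)
    (hc : (P.F1 ∧ P.L1) ∨ (P.F1 ∧ P.L2) ∨ (P.F2 ∧ P.L1) ∨ (P.F2 ∧ P.L2))
    {y : Fin n → ℝ} (hy : P.Feasible y) :
    ∃ x a, Monotone a ∧ P.FeasibleFor a x ∧ P.objective x ≤ P.objective y := by
  have hobj : Continuous P.objective := by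
    unfold objective
    exact continuous_finsetSum _ fun i _ =>
      P.φ_continuous.comp ((continuous_apply i).add continuous_const)
  let S : Set (Fin n → ℝ) := Set.univ.pi P.Allowed ∩ ({x | ∑ i, x i = P.R} ∩
    {x | P.objective x ≤ P.objective y})
  have hS : IsCompact S := by
    refine IsCompact.inter_right (isCompact_univ_pi fun i => isCompact_iUnion fun j => isCompact_Icc)
      (IsClosed.inter ?_ ?_)
    · exact isClosed_eq (by fun_prop) continuous_const
    · exact isClosed_le hobj continuous_const
  have hyS : y ∈ S := ⟨fun i _ => mem_allowed.2 (hy.2 i), hy.1, le_refl (P.objective y)⟩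
  -- The plain sum of squares would be unchanged by a swap. The shift by i makes it strictly favour
  -- the larger value at the larger index.
  obtain ⟨x, ⟨hxA, hxR, hxo⟩, hmin⟩ := hS.exists_isMinOn ⟨y, hyS⟩
    (f := fun x : Fin n → ℝ => ∑ i, (x i - (i : ℝ)) ^ 2) (by fun_prop)
  choose a ha using fun i => mem_allowed.1 (hxA i (Set.mem_univ i))
  refine ⟨x, a, ?_, ⟨hxR, ha⟩, hxo⟩
  rw [monotone_iff_forall_lt]
  intro s t hst
  by_contra hlt
  push Not at hlt
  obtain ⟨z, hzs, hzt, hwz, hzv⟩ := P.exists_exchange hc hst hlt (ha s) (ha t)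
  set x' := Function.update (Function.update x s z) t (x s + x t - z) with hx'
  have hx'S : x' ∈ S := by
    refine ⟨fun i _ => ?_, ?_, ?_⟩
    · by_cases hit : i = t
      · subst hit; simpa [hx'] using hzt
      · by_cases his : i = s
        · subst his; simpa [hx', hit] using hzs
        · simpa [hx', hit, his] using hxA i (Set.mem_univ i)
    · have := sum_update_update hst.ne (fun _ v => v) x z (x s + x t - z)
      simp only [Set.mem_ofPred_eq] at hxR ⊢
      rw [← hx'] at this
      linarith
    · have h1 := sum_update_update hst.ne (fun i v => P.φ (v + P.b i)) x z (x s + x t - z)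
      have hb := P.b_antitone hst.le
      -- The lower bound on the new shifted value of s uses w ≤ z together with b t ≤ b s.
      have h2 := P.φ_convex.add_le_add_of_between (a := x t + P.b t) (d := x s + P.b s)
        (p := z + P.b s) (q := x s + x t - z + P.b t) (by linarith) (by linarith) (by ring)
      simp only [Set.mem_ofPred_eq, objective] at hxo ⊢
      rw [← hx'] at h1
      linarith
  have h1 : ∑ i, (x i - (i : ℝ)) ^ 2 ≤ ∑ i, (x' i - (i : ℝ)) ^ 2 := hmin hx'S
  have h2 := sum_update_update hst.ne (fun i v => (v - (i : ℝ)) ^ 2) x z (x s + x t - z)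
  rw [← hx'] at h2
  have hst' : (s : ℝ) < (t : ℝ) := by exact_mod_cast hst
  -- The potential changes by -2 (v - z)(z - w) - 2 (v - z)(t - s), where v and w are the old values
  -- at s and t; the second term is strictly negative.
  nlinarith [mul_pos (sub_pos.2 hzv) (sub_pos.2 hst'),
    mul_nonneg (sub_nonneg.2 hwz) (sub_nonneg.2 hzv.le)]

/-! ### The subproblem of a fixed assignment -/

/-- The lower breakpoint of activity `i`. -/
def lowBp (P : RapDibc n m) (a : Fin n → Fin m) (i : Fin n) : ℝ := P.l i (a i) + P.b i

/-- The upper breakpoint of activity `i`. -/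
def highBp (P : RapDibc n m) (a : Fin n → Fin m) (i : Fin n) : ℝ := P.u i (a i) + P.b i

theorem lowBp_le_highBp (P : RapDibc n m) (a : Fin n → Fin m) (i : Fin n) :
    P.lowBp a i ≤ P.highBp a i := by
  have := P.l_le_u i (a i)
  simp only [lowBp, highBp]
  linarith

/-- The point of the interval of activity `i` that is nearest to `lam - b i`. -/
noncomputable def nearest (P : RapDibc n m) (a : Fin n → Fin m) (lam : EReal) (i : Fin n) : ℝ :=
  if lam ≤ (P.lowBp a i : EReal) then P.l i (a i)
  else if (P.highBp a i : EReal) ≤ lam then P.u i (a i)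
  else lam.toReal - P.b i

theorem nearest_top (P : RapDibc n m) (a : Fin n → Fin m) (i : Fin n) :
    P.nearest a ⊤ i = P.u i (a i) := by
  simp [nearest]

theorem nearest_bot (P : RapDibc n m) (a : Fin n → Fin m) (i : Fin n) :
    P.nearest a ⊥ i = P.l i (a i) := by
  simp [nearest]

theorem nearest_coe (P : RapDibc n m) (a : Fin n → Fin m) (lam : ℝ) (i : Fin n) :
    P.nearest a lam i = if lam ≤ P.lowBp a i then P.l i (a i)
      else if P.highBp a i ≤ lam then P.u i (a i) else lam - P.b i := by
  simp [nearest]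

theorem nearest_coe_add (P : RapDibc n m) (a : Fin n → Fin m) (lam : ℝ) (i : Fin n) :
    P.nearest a lam i + P.b i = if lam ≤ P.lowBp a i then P.lowBp a i
      else if P.highBp a i ≤ lam then P.highBp a i else lam := by
  rw [nearest_coe]
  split_ifs
  · rfl
  · rfl
  · ring

theorem nearest_mem (P : RapDibc n m) (a : Fin n → Fin m) (lam : EReal) (i : Fin n) :
    P.nearest a lam i ∈ Set.Icc (P.l i (a i)) (P.u i (a i)) := by
  have h := P.l_le_u i (a i)
  induction lam with
  | bot => rw [nearest_bot]; exact ⟨le_rfl, h⟩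
  | top => rw [nearest_top]; exact ⟨h, le_rfl⟩
  | coe lam =>
    rw [nearest_coe]
    split_ifs with h1 h2
    · exact ⟨le_rfl, h⟩
    · exact ⟨h, le_rfl⟩
    · simp only [lowBp, highBp] at h1 h2
      constructor <;> linarith

theorem nearest_mono (P : RapDibc n m) (a : Fin n → Fin m) (i : Fin n) {lam mu : EReal}
    (h : lam ≤ mu) : P.nearest a lam i ≤ P.nearest a mu i := by
  induction lam with
  | bot => rw [nearest_bot]; exact (P.nearest_mem a mu i).1
  | top => rw [top_le_iff.1 h]
  | coe lam =>
    induction mu with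
    | bot => simp at h
    | top => rw [nearest_top]; exact (P.nearest_mem a lam i).2
    | coe mu =>
      have h' : lam ≤ mu := by exact_mod_cast h
      have h0 := P.l_le_u i (a i)
      rw [nearest_coe, nearest_coe]
      split_ifs <;> simp only [lowBp, highBp] at * <;> linarith

theorem lt_of_sum_nearest_lt {P : RapDibc n m} {a : Fin n → Fin m} {lam mu : EReal}
    (h : ∑ i, P.nearest a lam i < ∑ i, P.nearest a mu i) : lam < mu := by
  by_contra hc
  exact absurd h (not_lt.2 (Finset.sum_le_sum fun i _ => P.nearest_mono a i (not_lt.1 hc)))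

/-- The optimality condition of the subproblem. -/
theorem objective_nearest_le (P : RapDibc n m) {a : Fin n → Fin m} {lam : ℝ}
    (hlam : ∑ i, P.nearest a lam i = P.R) {y : Fin n → ℝ} (hy : P.FeasibleFor a y) :
    P.objective (P.nearest a lam) ≤ P.objective y := by
  obtain ⟨g, hg⟩ := P.φ_convex.exists_slope_at_clamp lam
  have h : ∀ i, P.φ (P.nearest a lam i + P.b i) + g * (y i - P.nearest a lam i) ≤
      P.φ (y i + P.b i) := fun i => by
    have h1 := hg (P.lowBp a i) (P.highBp a i) (y i + P.b i)
      (by simp only [lowBp]; linarith [(hy.2 i).1]) (by simp only [highBp]; linarith [(hy.2 i).2])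
    rw [← nearest_coe_add] at h1
    convert h1 using 3
    ring
  have h2 := Finset.sum_le_sum fun i (_ : i ∈ Finset.univ) => h i
  -- Both points have sum R, so the terms with the common slope g cancel.
  rw [Finset.sum_add_distrib, ← Finset.mul_sum, Finset.sum_sub_distrib, hlam, hy.1] at h2
  simpa [objective] using h2

/-! ### Invariants of the breakpoint search -/

/-- The position of the multiplier relative to the breakpoints of an activity. -/
inductive Status where
  | low : Status
  | free : Status
  | up : Status

/-- Selection by status. -/
def Status.pick : Status → ℝ → ℝ → ℝ → ℝ
  | low, x, _, _ => x
  | free, _, y, _ => y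
  | up, _, _, z => z

@[simp] theorem Status.pick_low (x y z : ℝ) : Status.low.pick x y z = x := rfl

@[simp] theorem Status.pick_free (x y z : ℝ) : Status.free.pick x y z = y := rfl

@[simp] theorem Status.pick_up (x y z : ℝ) : Status.up.pick x y z = z := rfl

/-- The queues and the bookkeeping parameters fit to the status of the activities. -/
structure Consistent (P : RapDibc n m) (s : SearchState n m) (σ : Fin n → Status) : Prop where
  validA : s.qA.Valid
  validB : s.qB.Valid
  nodupA : s.qA.entries.Nodup
  nodupB : s.qB.entries.Nodup
  entryA : ∀ e ∈ s.qA.entries, e.1 = P.lowBp s.j e.2 ∨ e.1 = P.l e.2 P.last + P.b e.2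
  entryB : ∀ e ∈ s.qB.entries, e.1 = P.highBp s.j e.2 ∨ e.1 = P.u e.2 P.last + P.b e.2
  memA : ∀ i, (P.lowBp s.j i, i) ∈ s.qA.entries ↔ σ i = .low
  memB : ∀ i, (P.highBp s.j i, i) ∈ s.qB.entries ↔ σ i ≠ .up
  B_eq : s.B = ∑ i, (σ i).pick (P.l i (s.j i)) 0 (P.u i (s.j i))
  F_eq : s.F = ∑ i, (σ i).pick 0 (P.b i) 0
  NF_eq : s.NF = ∑ i, (σ i).pick 0 1 0
  VB_eq : s.VB = ∑ i, (σ i).pick (P.φ (P.lowBp s.j i)) 0 (P.φ (P.highBp s.j i))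

/-- An activity can own at most two different keys in a queue: its current breakpoint and an
outdated one from the last interval. -/
theorem card_le_two_mul {S : Multiset (ℝ × Fin n)} (hS : S.Nodup) (f g : Fin n → ℝ)
    (h : ∀ e ∈ S, e.1 = f e.2 ∨ e.1 = g e.2) : S.card ≤ 2 * n := by
  classical
  rw [← Multiset.toFinset_card_of_nodup hS]
  have hsub : S.toFinset ⊆ Finset.univ.image (fun i => (f i, i)) ∪
      Finset.univ.image (fun i => (g i, i)) := fun e he => by
    rw [Multiset.mem_toFinset] at he
    rw [Finset.mem_union, Finset.mem_image, Finset.mem_image]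
    rcases h e he with h | h
    · exact .inl ⟨e.2, Finset.mem_univ _, Prod.ext h.symm rfl⟩
    · exact .inr ⟨e.2, Finset.mem_univ _, Prod.ext h.symm rfl⟩
  have h1 := Finset.card_le_card hsub
  have h2 := Finset.card_union_le (Finset.univ.image (fun i => (f i, i)))
    (Finset.univ.image (fun i => (g i, i)))
  have h3 := Finset.card_image_le (s := Finset.univ) (f := fun i : Fin n => (f i, i))
  have h4 := Finset.card_image_le (s := Finset.univ) (f := fun i : Fin n => (g i, i))
  simp only [Finset.card_univ, Fintype.card_fin] at h3 h4
  omega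

namespace Consistent

variable {P : RapDibc n m} {s : SearchState n m} {σ : Fin n → Status}

theorem cardA_le (h : Consistent P s σ) : s.qA.entries.card ≤ 2 * n :=
  card_le_two_mul h.nodupA (P.lowBp s.j) (fun i => P.l i P.last + P.b i) h.entryA

theorem cardB_le (h : Consistent P s σ) : s.qB.entries.card ≤ 2 * n :=
  card_le_two_mul h.nodupB (P.highBp s.j) (fun i => P.u i P.last + P.b i) h.entryB

theorem NF_nonneg (h : Consistent P s σ) : 0 ≤ s.NF := by
  rw [h.NF_eq]
  exact Finset.sum_nonneg fun i _ => by cases σ i <;> simp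

/-- No current breakpoint lies strictly between those passed and those stored, so on this whole
range the status decides how the clamp acts. At the borders the neighbouring formulas agree, so weak
inequalities suffice. -/
theorem nearest_eq (h : Consistent P s σ) {lam : ℝ}
    (hA : ∀ e ∈ s.qA.entries, lam ≤ e.1) (hB : ∀ e ∈ s.qB.entries, lam ≤ e.1)
    (hA' : ∀ i, σ i ≠ .low → P.lowBp s.j i ≤ lam) (hB' : ∀ i, σ i = .up → P.highBp s.j i ≤ lam)
    (i : Fin n) :
    P.nearest s.j lam i = (σ i).pick (P.l i (s.j i)) (lam - P.b i) (P.u i (s.j i)) := by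
  have h1 := (h.memA i).2
  have h2 := (h.memB i).2
  have h3 := hA' i
  have h4 := hB' i
  have h5 := P.l_le_u i (s.j i)
  rw [nearest_coe]
  cases hi : σ i with
  | low =>
    have := hA _ (h1 hi)
    simp [this]
  | free =>
    have h6 := hB _ (h2 (by simp [hi]))
    have h7 := h3 (by simp [hi])
    split_ifs <;> simp only [lowBp, highBp, Status.pick_free] at * <;> linarith
  | up =>
    have h6 := h4 hi
    split_ifs <;> simp only [lowBp, highBp, Status.pick_up] at *
    linarith

/-- The bookkeeping numbers are the coefficients of the affine piece of the sum. It is valid at all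
multipliers between the passed and the stored breakpoints, not only at breakpoints. -/
theorem sum_nearest_eq (h : Consistent P s σ) {lam : ℝ}
    (hA : ∀ e ∈ s.qA.entries, lam ≤ e.1) (hB : ∀ e ∈ s.qB.entries, lam ≤ e.1)
    (hA' : ∀ i, σ i ≠ .low → P.lowBp s.j i ≤ lam)
    (hB' : ∀ i, σ i = .up → P.highBp s.j i ≤ lam) :
    ∑ i, P.nearest s.j lam i = s.B + s.NF * lam - s.F := by
  rw [h.B_eq, h.NF_eq, h.F_eq, Finset.sum_mul, ← Finset.sum_add_distrib, ← Finset.sum_sub_distrib]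
  refine Finset.sum_congr rfl fun i _ => ?_
  rw [h.nearest_eq hA hB hA' hB']
  cases σ i <;> simp

theorem objective_nearest_eq (h : Consistent P s σ) {lam : ℝ}
    (hA : ∀ e ∈ s.qA.entries, lam ≤ e.1) (hB : ∀ e ∈ s.qB.entries, lam ≤ e.1)
    (hA' : ∀ i, σ i ≠ .low → P.lowBp s.j i ≤ lam)
    (hB' : ∀ i, σ i = .up → P.highBp s.j i ≤ lam) :
    P.objective (P.nearest s.j lam) = s.VB + s.NF * P.φ lam := by
  rw [h.VB_eq, h.NF_eq, Finset.sum_mul, ← Finset.sum_add_distrib, objective]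
  refine Finset.sum_congr rfl fun i _ => ?_
  rw [h.nearest_eq hA hB hA' hB']
  cases σ i <;> simp [lowBp, highBp]

end Consistent

/-- The search has passed the breakpoints up to `L` and not yet reached the multiplier. -/
structure Searching (P : RapDibc n m) (L : EReal) (s : SearchState n m) (σ : Fin n → Status) :
    Prop where
  geA : ∀ e ∈ s.qA.entries, L ≤ (e.1 : EReal)
  geB : ∀ e ∈ s.qB.entries, L ≤ (e.1 : EReal)
  leA : ∀ i, σ i ≠ .low → (P.lowBp s.j i : EReal) ≤ L
  leB : ∀ i, σ i = .up → (P.highBp s.j i : EReal) ≤ L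
  below : L = ⊥ ∨ ∑ i, P.nearest s.j L i < P.R

/-- The search has passed exactly the breakpoints below `lam`. -/
structure Stopped (P : RapDibc n m) (lam : EReal) (s : SearchState n m) (σ : Fin n → Status) :
    Prop where
  geA : ∀ e ∈ s.qA.entries, lam ≤ (e.1 : EReal)
  geB : ∀ e ∈ s.qB.entries, lam ≤ (e.1 : EReal)
  ltA : ∀ i, σ i ≠ .low → (P.lowBp s.j i : EReal) < lam
  ltB : ∀ i, σ i = .up → (P.highBp s.j i : EReal) < lam

/-- `lam` and `V` are the multiplier and the value of the subproblem. -/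
def Outcome (P : RapDibc n m) (a : Fin n → Fin m) (lam V : EReal) : Prop :=
  (∃ t : ℝ, lam = t ∧ ∑ i, P.nearest a t i = P.R ∧ V = (P.objective (P.nearest a t) : EReal)) ∨
  (lam = ⊥ ∧ V = ⊤ ∧ P.R < ∑ i, P.l i (a i)) ∨
  (lam = ⊤ ∧ V = ⊤ ∧ ∑ i, P.u i (a i) < P.R)

theorem Outcome.le_objective {P : RapDibc n m} {a : Fin n → Fin m} {lam V : EReal}
    (h : P.Outcome a lam V) {y : Fin n → ℝ} (hy : P.FeasibleFor a y) :
    V ≤ (P.objective y : EReal) := by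
  rcases h with ⟨t, -, h1, rfl⟩ | ⟨-, -, h1⟩ | ⟨-, -, h1⟩
  · exact_mod_cast P.objective_nearest_le h1 hy
  · have := Finset.sum_le_sum fun i (_ : i ∈ Finset.univ) => (hy.2 i).1
    rw [hy.1] at this
    exact absurd h1 (not_lt.2 this)
  · have := Finset.sum_le_sum fun i (_ : i ∈ Finset.univ) => (hy.2 i).2
    rw [hy.1] at this
    exact absurd h1 (not_lt.2 this)

/-! ### Primitive operations and the cost of one iteration -/

/-- The number of stored breakpoints. -/
def queueSize (s : SearchState n m) : ℕ := s.qA.entries.card + s.qB.entries.card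

@[simp] theorem val_alpha (P : RapDibc n m) (a : Fin n → Fin m) (i : Fin n) :
    (P.alpha a i).val = P.lowBp a i := rfl

@[simp] theorem val_beta (P : RapDibc n m) (a : Fin n → Fin m) (i : Fin n) :
    (P.beta a i).val = P.highBp a i := rfl

@[simp] theorem val_lower (P : RapDibc n m) (a : Fin n → Fin m) (i : Fin n) :
    (P.lower a i).val = P.l i (a i) := rfl

@[simp] theorem val_upper (P : RapDibc n m) (a : Fin n → Fin m) (i : Fin n) :
    (P.upper a i).val = P.u i (a i) := rfl

@[simp] theorem time_alpha (P : RapDibc n m) (a : Fin n → Fin m) (i : Fin n) :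
    (P.alpha a i).time = 4 := rfl

@[simp] theorem time_beta (P : RapDibc n m) (a : Fin n → Fin m) (i : Fin n) :
    (P.beta a i).time = 4 := rfl

@[simp] theorem time_lower (P : RapDibc n m) (a : Fin n → Fin m) (i : Fin n) :
    (P.lower a i).time = 2 := rfl

@[simp] theorem time_upper (P : RapDibc n m) (a : Fin n → Fin m) (i : Fin n) :
    (P.upper a i).time = 2 := rfl

@[simp] theorem val_evalPhi (P : RapDibc n m) (flops : ℕ) (x : ℝ) :
    (P.evalPhi flops x).val = P.φ x := rfl

@[simp] theorem time_evalPhi (P : RapDibc n m) (flops : ℕ) (x : ℝ) :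
    (P.evalPhi flops x).time = flops := rfl

theorem time_minBreakpoint_le (qA qB : BpQueue n) : (minBreakpoint qA qB).time ≤ 4 := by
  simp only [minBreakpoint, time_bind, BpQueue.time_peek]
  split
  · simp
  · simp
  · simp
  · simp only [time_bind, time_ite]
    simp [Timed.le]

/-- Ties go to the lower breakpoints, whence the strict inequality in the last case. It guarantees
that an activity leaves its lower bound before its upper breakpoint is processed, even if its
interval is a point. -/
theorem minBreakpoint_cases {qA qB : BpQueue n} (hA : qA.Valid) (hB : qB.Valid) :
    ((minBreakpoint qA qB).val = none ∧ qA.entries = 0 ∧ qB.entries = 0) ∨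
    (∃ e, (minBreakpoint qA qB).val = some (true, e) ∧ qA.peek.val = some e ∧
      (∀ e' ∈ qA.entries, e.1 ≤ e'.1) ∧ ∀ e' ∈ qB.entries, e.1 ≤ e'.1) ∨
    (∃ e, (minBreakpoint qA qB).val = some (false, e) ∧ qB.peek.val = some e ∧
      (∀ e' ∈ qA.entries, e.1 < e'.1) ∧ ∀ e' ∈ qB.entries, e.1 ≤ e'.1) := by
  cases ha : qA.peek.val with
  | none =>
    have ha0 := BpQueue.entries_of_peek_eq_none ha
    cases hb : qB.peek.val with
    | none => exact .inl ⟨by simp [minBreakpoint, ha, hb], ha0, BpQueue.entries_of_peek_eq_none hb⟩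
    | some e =>
      refine .inr (.inr ⟨e, by simp [minBreakpoint, ha, hb], rfl, by simp [ha0],
        fun e' he' => hB.le_of_peek hb he'⟩)
  | some e =>
    cases hb : qB.peek.val with
    | none =>
      have hb0 := BpQueue.entries_of_peek_eq_none hb
      exact .inr (.inl ⟨e, by simp [minBreakpoint, ha, hb], rfl,
        fun e' he' => hA.le_of_peek ha he', by simp [hb0]⟩)
    | some e₂ =>
      by_cases h : e.1 ≤ e₂.1
      · exact .inr (.inl ⟨e, by simp [minBreakpoint, ha, hb, h], rfl,
          fun e' he' => hA.le_of_peek ha he', fun e' he' => h.trans (hB.le_of_peek hb he')⟩)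
      · exact .inr (.inr ⟨e₂, by simp [minBreakpoint, ha, hb, h], rfl,
          fun e' he' => (not_le.1 h).trans_le (hA.le_of_peek ha he'),
          fun e' he' => hB.le_of_peek hb he'⟩)

theorem time_searchStep_le (P : RapDibc n m) (flops : ℕ) {s : SearchState n m}
    {σ : Fin n → Status} (h : Consistent P s σ) :
    (P.searchStep flops s).time ≤ 14 * Nat.log 2 (2 * n + 1) + flops + 40 := by
  have h0 := time_minBreakpoint_le s.qA s.qB
  have hA := BpQueue.time_popMin_le h.validA h.cardA_le
  have hB := BpQueue.time_popMin_le h.validB h.cardB_le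
  simp only [searchStep, time_bind]
  generalize (minBreakpoint s.qA s.qB).val = bp
  rcases bp with _ | ⟨isLower, lam, i⟩
  · simp only [time_pure]
    omega
  · have h1 := Classical.propComplete (lam = if isLower = true then P.lowBp s.j i else P.highBp s.j i)
    rcases h1 with h1 | h1
    · rcases Classical.propComplete (s.B + s.NF * lam - s.F = P.R) with h2 | h2
      · simp only [time_bind, val_alpha, val_beta, h1, h2, Timed.eq, Timed.mul, Timed.add, Timed.sub,
          time_op, time_pure, time_evalPhi, val_op, decide_true, if_true, time_alpha, time_beta]
        linarith
      rcases Classical.propComplete (P.R < s.B + s.NF * lam - s.F) with h3 | h3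
      · rcases Classical.propComplete (s.NF = 0) with h4 | h4 <;>
        · simp only [time_bind, val_alpha, val_beta, h1, h2, h3, h4, Timed.eq, Timed.mul, Timed.add,
            Timed.sub, Timed.div, Timed.lt, time_op, time_pure, time_evalPhi, val_op, decide_true,
            decide_false, if_true, if_false, time_alpha, time_beta, Bool.false_eq_true]
          linarith
      · cases isLower <;>
        · simp only [Bool.false_eq_true, if_false, if_true] at h1
          simp only [time_bind, val_alpha, val_beta, h1, h2, h3, Timed.eq, Timed.mul, Timed.add,
            Timed.sub, Timed.lt, time_op, time_pure, time_evalPhi, val_op, decide_true,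
            decide_false, if_true, if_false, time_alpha, time_beta, time_lower, time_upper,
            Bool.false_eq_true]
          linarith
    · cases isLower <;>
      · simp only [Bool.false_eq_true, if_false, if_true] at h1
        simp only [time_bind, val_alpha, val_beta, h1, Timed.eq, time_op, time_pure, val_op,
          decide_false, if_true, if_false, time_alpha, time_beta, Bool.false_eq_true]
        linarith

/-! ### Removing a breakpoint -/

namespace Consistent

variable {P : RapDibc n m} {s : SearchState n m} {σ : Fin n → Status}

/-- The status is tied only to the presence of current keys, so dropping an outdated entry changes
neither the status nor the sums. -/
theorem popA_of_ne (h : Consistent P s σ) {lam : ℝ} {i : Fin n}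
    (hp : s.qA.peek.val = some (lam, i)) (hne : lam ≠ P.lowBp s.j i) :
    Consistent P { s with qA := s.qA.popMin.val } σ := by
  have hE := BpQueue.exists_entries_popMin hp
  have hn := h.nodupA
  rw [hE, Multiset.nodup_cons] at hn
  exact { h with
    validA := h.validA.popMin
    nodupA := hn.2
    entryA := fun e he => h.entryA e (by rw [hE]; exact Multiset.mem_cons_of_mem he)
    memA := fun k => by
      rw [← h.memA k, hE, Multiset.mem_cons]
      refine ⟨.inr, fun h' => h'.resolve_left fun h'' => ?_⟩
      rw [Prod.mk.injEq] at h''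
      obtain ⟨h1, rfl⟩ := h''
      exact hne h1.symm }

theorem popB_of_ne (h : Consistent P s σ) {lam : ℝ} {i : Fin n}
    (hp : s.qB.peek.val = some (lam, i)) (hne : lam ≠ P.highBp s.j i) :
    Consistent P { s with qB := s.qB.popMin.val } σ := by
  have hE := BpQueue.exists_entries_popMin hp
  have hn := h.nodupB
  rw [hE, Multiset.nodup_cons] at hn
  exact { h with
    validB := h.validB.popMin
    nodupB := hn.2
    entryB := fun e he => h.entryB e (by rw [hE]; exact Multiset.mem_cons_of_mem he)
    memB := fun k => by
      rw [← h.memB k, hE, Multiset.mem_cons]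
      refine ⟨.inr, fun h' => h'.resolve_left fun h'' => ?_⟩
      rw [Prod.mk.injEq] at h''
      obtain ⟨h1, rfl⟩ := h''
      exact hne h1.symm }

theorem status_of_peekA (h : Consistent P s σ) {i : Fin n}
    (hp : s.qA.peek.val = some (P.lowBp s.j i, i)) : σ i = .low := by
  rw [← h.memA, BpQueue.exists_entries_popMin hp]
  exact Multiset.mem_cons_self _ _

theorem popA_of_eq (h : Consistent P s σ) {i : Fin n}
    (hp : s.qA.peek.val = some (P.lowBp s.j i, i)) :
    Consistent P { s with
      qA := s.qA.popMin.val
      B := s.B - P.l i (s.j i)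
      F := s.F + P.b i
      NF := s.NF + 1
      VB := s.VB - P.φ (P.lowBp s.j i) } (Function.update σ i .free) := by
  have hE := BpQueue.exists_entries_popMin hp
  have hn := h.nodupA
  rw [hE, Multiset.nodup_cons] at hn
  have hi := h.status_of_peekA hp
  have hne : ∀ k, k ≠ i → Function.update σ i .free k = σ k := fun k hk =>
    Function.update_of_ne hk _ _
  exact {
    validA := h.validA.popMin
    validB := h.validB
    nodupA := hn.2
    nodupB := h.nodupB
    entryA := fun e he => h.entryA e (by rw [hE]; exact Multiset.mem_cons_of_mem he)
    entryB := h.entryB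
    memA := fun k => by
      by_cases hk : k = i
      · subst hk
        simp only [Function.update_self, reduceCtorEq, iff_false]
        exact hn.1
      · rw [hne k hk, ← h.memA k, hE, Multiset.mem_cons]
        simp [hk]
    memB := fun k => by
      rw [h.memB k]
      by_cases hk : k = i
      · subst hk
        simp [hi]
      · rw [hne k hk]
    B_eq := by
      rw [Fintype.sum_eq_sub_add i
        (f := fun k => (σ k).pick (P.l k (s.j k)) 0 (P.u k (s.j k))) fun k hk => by rw [hne k hk]]
      simp [h.B_eq, hi]
    F_eq := by
      rw [Fintype.sum_eq_sub_add i
        (f := fun k => (σ k).pick 0 (P.b k) 0) fun k hk => by rw [hne k hk]]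
      simp [h.F_eq, hi]
    NF_eq := by
      rw [Fintype.sum_eq_sub_add i
        (f := fun k => (σ k).pick 0 1 0) fun k hk => by rw [hne k hk]]
      simp [h.NF_eq, hi]
    VB_eq := by
      rw [Fintype.sum_eq_sub_add i
        (f := fun k => (σ k).pick (P.φ (P.lowBp s.j k)) 0 (P.φ (P.highBp s.j k)))
        fun k hk => by rw [hne k hk]]
      simp [h.VB_eq, hi] }

theorem popB_of_eq (h : Consistent P s σ) {i : Fin n}
    (hp : s.qB.peek.val = some (P.highBp s.j i, i)) (hi : σ i = .free) :
    Consistent P { s with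
      qB := s.qB.popMin.val
      B := s.B + P.u i (s.j i)
      F := s.F - P.b i
      NF := s.NF - 1
      VB := s.VB + P.φ (P.highBp s.j i) } (Function.update σ i .up) := by
  have hE := BpQueue.exists_entries_popMin hp
  have hn := h.nodupB
  rw [hE, Multiset.nodup_cons] at hn
  have hne : ∀ k, k ≠ i → Function.update σ i .up k = σ k := fun k hk =>
    Function.update_of_ne hk _ _
  exact {
    validA := h.validA
    validB := h.validB.popMin
    nodupA := h.nodupA
    nodupB := hn.2
    entryA := h.entryA
    entryB := fun e he => h.entryB e (by rw [hE]; exact Multiset.mem_cons_of_mem he)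
    memA := fun k => by
      rw [h.memA k]
      by_cases hk : k = i
      · subst hk
        simp [hi]
      · rw [hne k hk]
    memB := fun k => by
      by_cases hk : k = i
      · subst hk
        simp only [Function.update_self, ne_eq, not_true, iff_false]
        exact hn.1
      · rw [hne k hk, ← h.memB k, hE, Multiset.mem_cons]
        simp [hk]
    B_eq := by
      rw [Fintype.sum_eq_sub_add i
        (f := fun k => (σ k).pick (P.l k (s.j k)) 0 (P.u k (s.j k))) fun k hk => by rw [hne k hk]]
      simp [h.B_eq, hi]
    F_eq := by
      rw [Fintype.sum_eq_sub_add i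
        (f := fun k => (σ k).pick 0 (P.b k) 0) fun k hk => by rw [hne k hk]]
      simp [h.F_eq, hi]
    NF_eq := by
      rw [Fintype.sum_eq_sub_add i
        (f := fun k => (σ k).pick 0 1 0) fun k hk => by rw [hne k hk]]
      simp [h.NF_eq, hi]
    VB_eq := by
      rw [Fintype.sum_eq_sub_add i
        (f := fun k => (σ k).pick (P.φ (P.lowBp s.j k)) 0 (P.φ (P.highBp s.j k)))
        fun k hk => by rw [hne k hk]]
      simp [h.VB_eq, hi] }

end Consistent

/-! ### Progress and delivery of the search -/

namespace Searching

variable {P : RapDibc n m} {L : EReal} {s : SearchState n m} {σ : Fin n → Status}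

/-- For L = ⊥ nothing has been passed and the strict bounds hold vacuously; therefore strictness is
demanded only for other L. -/
theorem stopped (h : Searching P L s σ) {lam : EReal} (hL : L ≠ ⊥ → L < lam)
    (hA : ∀ e ∈ s.qA.entries, lam ≤ (e.1 : EReal)) (hB : ∀ e ∈ s.qB.entries, lam ≤ (e.1 : EReal)) :
    Stopped P lam s σ where
  geA := hA
  geB := hB
  ltA i hi := (h.leA i hi).trans_lt (hL (by
    rintro rfl
    simpa using h.leA i hi))
  ltB i hi := (h.leB i hi).trans_lt (hL (by
    rintro rfl
    simpa using h.leB i hi))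

theorem sum_lt (h : Searching P L s σ) (hL : L ≠ ⊥) : ∑ i, P.nearest s.j L i < P.R :=
  h.below.resolve_left hL

theorem lt_of_le_sum (h : Searching P L s σ) {lam : EReal}
    (hlam : P.R ≤ ∑ i, P.nearest s.j lam i) (hL : L ≠ ⊥) : L < lam :=
  lt_of_sum_nearest_lt ((h.sum_lt hL).trans_le hlam)

/-- Without remaining breakpoints, the upper bounds are too small. -/
theorem exhausted (hn : 0 < n) (hc : Consistent P s σ) (h : Searching P L s σ)
    (hA : s.qA.entries = 0) (hB : s.qB.entries = 0) :
    Stopped P ⊤ s σ ∧ P.Outcome s.j ⊤ ⊤ := by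
  have hup : ∀ i, σ i = .up := fun i => by
    by_contra hi
    have := (hc.memB i).2 hi
    simp [hB] at this
  have hL : L ≠ ⊥ := by
    rintro rfl
    have := h.leB ⟨0, hn⟩ (hup _)
    simp at this
  have hsum : ∑ i, P.nearest s.j L i = ∑ i, P.u i (s.j i) := by
    refine Finset.sum_congr rfl fun i _ => ?_
    have h1 := h.leB i (hup i)
    have h2 := P.lowBp_le_highBp s.j i
    rw [nearest]
    split_ifs with h3
    · have h4 : P.highBp s.j i ≤ P.lowBp s.j i := by exact_mod_cast h1.trans h3
      simp only [lowBp, highBp] at h2 h4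
      linarith
    · rfl
  have hlt := h.sum_lt hL
  rw [hsum] at hlt
  exact ⟨⟨by simp [hA], by simp [hB], fun i _ => EReal.coe_lt_top _, fun i _ => EReal.coe_lt_top _⟩,
    .inr (.inr ⟨rfl, rfl, hlt⟩)⟩

section

variable {lam : ℝ} (hc : Consistent P s σ) (h : Searching P L s σ) (hL : L ≤ lam)
  (hA : ∀ e ∈ s.qA.entries, lam ≤ e.1) (hB : ∀ e ∈ s.qB.entries, lam ≤ e.1)

include h hL in
theorem lowBp_le (i : Fin n) (hi : σ i ≠ .low) : P.lowBp s.j i ≤ lam := by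
  exact_mod_cast (h.leA i hi).trans hL

include h hL in
theorem highBp_le (i : Fin n) (hi : σ i = .up) : P.highBp s.j i ≤ lam := by
  exact_mod_cast (h.leB i hi).trans hL

include hc h hL hA hB

theorem sum_nearest_eq : ∑ i, P.nearest s.j lam i = s.B + s.NF * lam - s.F :=
  hc.sum_nearest_eq hA hB (h.lowBp_le hL) (h.highBp_le hL)

theorem deliver_eq (hz : s.B + s.NF * lam - s.F = P.R) :
    Stopped P lam s σ ∧ P.Outcome s.j lam ((s.VB + s.NF * P.φ lam : ℝ) : EReal) := by
  have hsum := h.sum_nearest_eq hc hL hA hB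
  rw [hz] at hsum
  refine ⟨h.stopped (h.lt_of_le_sum hsum.ge) (fun e he => by exact_mod_cast hA e he)
    (fun e he => by exact_mod_cast hB e he), .inl ⟨lam, rfl, hsum, ?_⟩⟩
  rw [hc.objective_nearest_eq hA hB (h.lowBp_le hL) (h.highBp_le hL)]

/-- The affine piece that is valid at lam already starts at L, where the sum is below R. A crossing
of R therefore happens on this piece. -/
theorem sum_nearest_bracket (hL0 : L ≠ ⊥) : L = (L.toReal : EReal) ∧
    s.B + s.NF * L.toReal - s.F < P.R := by
  have hLt : L ≠ ⊤ := (hL.trans_lt (EReal.coe_lt_top lam)).ne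
  have hLr : ((L.toReal : ℝ) : EReal) = L := EReal.coe_toReal hLt hL0
  refine ⟨hLr.symm, ?_⟩
  have hle : L.toReal ≤ lam := by
    rw [← hLr] at hL
    exact_mod_cast hL
  rw [← h.sum_nearest_eq hc hLr.ge (fun e he => hle.trans (hA e he))
    (fun e he => hle.trans (hB e he)), hLr]
  exact h.sum_lt hL0

/-- With no free activity the piece is constant, which excludes a finite starting point, where the
sum was below R. So nothing has been passed, and already the lower bounds exceed R. -/
theorem deliver_bot (hz : P.R < s.B + s.NF * lam - s.F) (h0 : s.NF = 0) :
    Stopped P ⊥ s σ ∧ P.Outcome s.j ⊥ ⊤ := by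
  have hL0 : L = ⊥ := by
    by_contra hL0
    have := (h.sum_nearest_bracket hc hL hA hB hL0).2
    rw [h0] at this hz
    linarith
  refine ⟨h.stopped (fun h' => absurd hL0 h') (fun _ _ => bot_le) (fun _ _ => bot_le),
    .inr (.inl ⟨rfl, rfl, ?_⟩)⟩
  rw [← h.sum_nearest_eq hc hL hA hB] at hz
  convert hz using 2 with i
  rw [hc.nearest_eq hA hB (h.lowBp_le hL) (h.highBp_le hL)]
  have hlow : σ i = .low := by
    by_contra hi
    have := h.leA i hi
    simp [hL0] at this
  simp [hlow]

/-- A free activity shows that L ≠ ⊥. The affine piece is below R at L and above R at lam, so its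
solution mu lies between, and `deliver_eq` applies at mu although mu need not be a breakpoint. -/
theorem deliver_between (hz : P.R < s.B + s.NF * lam - s.F) (h0 : s.NF ≠ 0) {mu : ℝ}
    (hmu : mu = (P.R - s.B + s.F) / s.NF) :
    Stopped P mu s σ ∧ P.Outcome s.j mu ((s.VB + s.NF * P.φ mu : ℝ) : EReal) := by
  have hpos : 0 < s.NF := lt_of_le_of_ne hc.NF_nonneg (Ne.symm h0)
  have hmu' : s.NF * mu = P.R - s.B + s.F := by
    rw [hmu]
    field_simp
  have hlt : mu < lam := by
    by_contra hcon
    have := mul_le_mul_of_nonneg_left (not_lt.1 hcon) hpos.le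
    linarith
  have hL0 : L ≠ ⊥ := by
    intro hL0
    refine h0 ?_
    rw [hc.NF_eq]
    refine Finset.sum_eq_zero fun i _ => ?_
    have hlow : σ i = .low := by
      by_contra hi
      have := h.leA i hi
      simp [hL0] at this
    simp [hlow]
  obtain ⟨hLr, hLlt⟩ := h.sum_nearest_bracket hc hL hA hB hL0
  have hLmu : L ≤ mu := by
    rw [hLr]
    refine EReal.coe_le_coe_iff.2 ?_
    by_contra hcon
    have := mul_le_mul_of_nonneg_left (not_le.1 hcon).le hpos.le
    linarith
  exact h.deliver_eq hc hLmu (fun e he => hlt.le.trans (hA e he))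
    (fun e he => hlt.le.trans (hB e he)) (by linarith)

theorem passA {i : Fin n} (hp : s.qA.peek.val = some (lam, i)) (hlam : lam = P.lowBp s.j i)
    (hz : s.B + s.NF * lam - s.F < P.R) {s' : SearchState n m} (hj : s'.j = s.j)
    (hqA : s'.qA = s.qA.popMin.val) (hqB : s'.qB = s.qB) :
    Searching P lam s' (Function.update σ i .free) where
  geA e he := by
    rw [hqA] at he
    refine EReal.coe_le_coe_iff.2 (hA e ?_)
    rw [BpQueue.exists_entries_popMin hp]
    exact Multiset.mem_cons_of_mem he
  geB e he := by
    rw [hqB] at he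
    exact EReal.coe_le_coe_iff.2 (hB e he)
  leA k hk := by
    rw [hj]
    by_cases hki : k = i
    · subst hki
      rw [hlam]
    · rw [Function.update_of_ne hki] at hk
      exact (h.leA k hk).trans hL
  leB k hk := by
    rw [hj]
    by_cases hki : k = i
    · subst hki
      simp at hk
    · rw [Function.update_of_ne hki] at hk
      exact (h.leB k hk).trans hL
  below := by
    rw [hj, h.sum_nearest_eq hc hL hA hB]
    exact .inr hz

theorem passB {i : Fin n} (hp : s.qB.peek.val = some (lam, i)) (hlam : lam = P.highBp s.j i)
    (hz : s.B + s.NF * lam - s.F < P.R) {s' : SearchState n m} (hj : s'.j = s.j)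
    (hqA : s'.qA = s.qA) (hqB : s'.qB = s.qB.popMin.val) :
    Searching P lam s' (Function.update σ i .up) where
  geA e he := by
    rw [hqA] at he
    exact EReal.coe_le_coe_iff.2 (hA e he)
  geB e he := by
    rw [hqB] at he
    refine EReal.coe_le_coe_iff.2 (hB e ?_)
    rw [BpQueue.exists_entries_popMin hp]
    exact Multiset.mem_cons_of_mem he
  leA k hk := by
    rw [hj]
    by_cases hki : k = i
    · subst hki
      rw [hlam]
      exact EReal.coe_le_coe_iff.2 (P.lowBp_le_highBp s.j k)
    · rw [Function.update_of_ne hki] at hk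
      exact (h.leA k hk).trans hL
  leB k hk := by
    rw [hj]
    by_cases hki : k = i
    · subst hki
      rw [hlam]
    · rw [Function.update_of_ne hki] at hk
      exact (h.leB k hk).trans hL
  below := by
    rw [hj, h.sum_nearest_eq hc hL hA hB]
    exact .inr hz

end

theorem popA (h : Searching P L s σ) {e : ℝ × Fin n} (hp : s.qA.peek.val = some e) :
    Searching P L { s with qA := s.qA.popMin.val } σ :=
  { h with geA := fun e' he' => h.geA e' (by
      rw [BpQueue.exists_entries_popMin hp]; exact Multiset.mem_cons_of_mem he') }

theorem popB (h : Searching P L s σ) {e : ℝ × Fin n} (hp : s.qB.peek.val = some e) :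
    Searching P L { s with qB := s.qB.popMin.val } σ :=
  { h with geB := fun e' he' => h.geB e' (by
      rw [BpQueue.exists_entries_popMin hp]; exact Multiset.mem_cons_of_mem he') }

end Searching

theorem queueSize_popA {s s' : SearchState n m} {e : ℝ × Fin n} (hp : s.qA.peek.val = some e)
    (hA : s'.qA = s.qA.popMin.val) (hB : s'.qB = s.qB) : queueSize s' + 1 = queueSize s := by
  rw [queueSize, queueSize, BpQueue.exists_entries_popMin hp, hA, hB, Multiset.card_cons]
  ring

theorem queueSize_popB {s s' : SearchState n m} {e : ℝ × Fin n} (hp : s.qB.peek.val = some e)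
    (hA : s'.qA = s.qA) (hB : s'.qB = s.qB.popMin.val) : queueSize s' + 1 = queueSize s := by
  rw [queueSize, queueSize, BpQueue.exists_entries_popMin hp, hA, hB, Multiset.card_cons]
  ring

theorem searchStep_spec (hn : 0 < n) {P : RapDibc n m} (flops : ℕ) {L : EReal}
    {s : SearchState n m} {σ : Fin n → Status} (hc : Consistent P s σ) (h : Searching P L s σ) :
    (∃ s' L' σ', (P.searchStep flops s).val = (s', none) ∧ Consistent P s' σ' ∧
      Searching P L' s' σ' ∧ s'.j = s.j ∧ queueSize s' + 1 = queueSize s) ∨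
    ∃ lam V, (P.searchStep flops s).val = (s, some (lam, V)) ∧ Stopped P lam s σ ∧
      P.Outcome s.j lam V := by
  rcases minBreakpoint_cases hc.validA hc.validB with ⟨hm, hA, hB⟩ | ⟨⟨lam, i⟩, hm, hp, hA, hB⟩ |
      ⟨⟨lam, i⟩, hm, hp, hA, hB⟩
  · exact .inr ⟨⊤, ⊤, by simp [searchStep, hm], h.exhausted hn hc hA hB⟩
  · have hL : L ≤ lam := h.geA (lam, i)
      (by rw [BpQueue.exists_entries_popMin hp]; exact Multiset.mem_cons_self _ _)
    by_cases h1 : lam = P.lowBp s.j i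
    · have h1' := eq_true h1
      rcases lt_trichotomy (s.B + s.NF * lam - s.F) P.R with h2 | h2 | h2
      · refine .inl ⟨_, lam, Function.update σ i .free, ?_, hc.popA_of_eq (i := i) (h1 ▸ hp),
          h.passA hc hL hA hB hp h1 h2 rfl rfl rfl, rfl, queueSize_popA hp rfl rfl⟩
        simp [searchStep, hm, h1', h2.ne, h2.not_gt]
      · refine .inr ⟨lam, _, ?_, h.deliver_eq hc hL hA hB h2⟩
        simp [searchStep, hm, h1', h2]
      · by_cases h3 : s.NF = 0
        · refine .inr ⟨⊥, ⊤, ?_, h.deliver_bot hc hL hA hB h2 h3⟩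
          simp [searchStep, hm, h1', h2.ne', h2, eq_true h3]
        · refine .inr ⟨_, _, ?_, h.deliver_between hc hL hA hB h2 h3 rfl⟩
          simp [searchStep, hm, h1', h2.ne', h2, h3]
    · refine .inl ⟨_, L, σ, ?_, hc.popA_of_ne hp h1, h.popA hp, rfl, queueSize_popA hp rfl rfl⟩
      simp [searchStep, hm, h1]
  · have hL : L ≤ lam := h.geB (lam, i)
      (by rw [BpQueue.exists_entries_popMin hp]; exact Multiset.mem_cons_self _ _)
    have hA' : ∀ e ∈ s.qA.entries, lam ≤ e.1 := fun e he => (hA e he).le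
    by_cases h1 : lam = P.highBp s.j i
    · have h1' := eq_true h1
      -- Status `up` is excluded because the current upper breakpoint is still stored; status `low`
      -- because its lower breakpoint would have won the comparison.
      have hfree : σ i = .free := by
        have h4 : σ i ≠ .up := by
          rw [← hc.memB i, BpQueue.exists_entries_popMin hp, h1]
          exact Multiset.mem_cons_self _ _
        have h5 : σ i ≠ .low := fun h5 => by
          have h6 := hA _ ((hc.memA i).2 h5)
          have h7 := P.lowBp_le_highBp s.j i
          simp only at h6
          linarith
        cases h8 : σ i with
        | low => exact absurd h8 h5
        | free => rfl
        | up => exact absurd h8 h4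
      rcases lt_trichotomy (s.B + s.NF * lam - s.F) P.R with h2 | h2 | h2
      · refine .inl ⟨_, lam, Function.update σ i .up, ?_, hc.popB_of_eq (i := i) (h1 ▸ hp) hfree,
          h.passB hc hL hA' hB hp h1 h2 rfl rfl rfl, rfl, queueSize_popB hp rfl rfl⟩
        simp [searchStep, hm, h1', h2.ne, h2.not_gt]
      · refine .inr ⟨lam, _, ?_, h.deliver_eq hc hL hA' hB h2⟩
        simp [searchStep, hm, h1', h2]
      · by_cases h3 : s.NF = 0
        · refine .inr ⟨⊥, ⊤, ?_, h.deliver_bot hc hL hA' hB h2 h3⟩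
          simp [searchStep, hm, h1', h2.ne', h2, eq_true h3]
        · refine .inr ⟨_, _, ?_, h.deliver_between hc hL hA' hB h2 h3 rfl⟩
          simp [searchStep, hm, h1', h2.ne', h2, h3]
    · refine .inl ⟨_, L, σ, ?_, hc.popB_of_ne hp h1, h.popB hp, rfl, queueSize_popB hp rfl rfl⟩
      simp [searchStep, hm, h1]

/-- Time is charged to the decrease of the queue size, plus one for the delivering iteration. Kept
in this form, the bounds of successive searches telescope. -/
theorem repeatUntil_searchStep_spec (hn : 0 < n) {P : RapDibc n m} (flops : ℕ) {L : EReal}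
    {s : SearchState n m} {σ : Fin n → Status} (hc : Consistent P s σ) (h : Searching P L s σ)
    {k : ℕ} (hk : queueSize s < k) :
    ∃ s' σ' lam V, (repeatUntil (P.searchStep flops) k s).val = (s', some (lam, V)) ∧
      Consistent P s' σ' ∧ Stopped P lam s' σ' ∧ P.Outcome s'.j lam V ∧ s'.j = s.j ∧
      queueSize s' ≤ queueSize s ∧ (repeatUntil (P.searchStep flops) k s).time ≤
        (queueSize s - queueSize s' + 1) * (14 * Nat.log 2 (2 * n + 1) + flops + 41) := by
  induction k generalizing s L σ with
  | zero => omega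
  | succ k ih =>
    have ht := P.time_searchStep_le flops hc
    rcases searchStep_spec hn flops hc h with ⟨s₁, L₁, σ₁, hv, hc₁, h₁, hj, hq⟩ |
        ⟨lam, V, hv, hst, ho⟩
    · obtain ⟨s', σ', lam, V, hv', hc', hst, ho, hj', hq', ht'⟩ := ih hc₁ h₁ (by omega)
      refine ⟨s', σ', lam, V, ?_, hc', hst, ho, hj'.trans hj, by omega, ?_⟩
      · simp [repeatUntil, hv, hv']
      · have hq2 : queueSize s - queueSize s' + 1 = (queueSize s₁ - queueSize s' + 1) + 1 := by
          omega
        rw [hq2, add_mul]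
        simp only [repeatUntil, time_bind, time_tick, hv]
        linarith
    · refine ⟨s, σ, lam, V, ?_, hc, hst, ho, rfl, le_rfl, ?_⟩
      · simp [repeatUntil, hv]
      · simp only [repeatUntil, time_bind, time_tick, hv, time_pure, Nat.sub_self]
        linarith

theorem Consistent.queueSize_le {P : RapDibc n m} {s : SearchState n m} {σ : Fin n → Status}
    (hc : Consistent P s σ) : queueSize s ≤ 4 * n := by
  have h1 := hc.cardA_le
  have h2 := hc.cardB_le
  rw [queueSize]
  omega

theorem search_spec (hn : 0 < n) {P : RapDibc n m} (flops : ℕ) {L : EReal}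
    {s : SearchState n m} {σ : Fin n → Status} (hc : Consistent P s σ) (h : Searching P L s σ) :
    ∃ s' σ' lam V, (P.search flops s).val = (s', some (lam, V)) ∧
      Consistent P s' σ' ∧ Stopped P lam s' σ' ∧ P.Outcome s'.j lam V ∧ s'.j = s.j ∧
      queueSize s' ≤ queueSize s ∧ (P.search flops s).time ≤
        (queueSize s - queueSize s' + 1) * (14 * Nat.log 2 (2 * n + 1) + flops + 41) :=
  repeatUntil_searchStep_spec hn flops hc h (Nat.lt_succ_of_le hc.queueSize_le)

/-! ### Moving an activity out of the last interval -/

theorem penult_lt_last (P : RapDibc n m) : P.penult < P.last := by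
  have := P.two_le
  rw [Fin.lt_def]
  simp only [penult, last]
  omega

/-- The comparisons recover the status because exactly the breakpoints strictly below lam have been
passed. This is why `Stopped` needs strict inequalities where `Searching` has weak ones. -/
theorem val_removeOld {P : RapDibc n m} (flops : ℕ) {lam : EReal} {s : SearchState n m}
    {σ : Fin n → Status} (hc : Consistent P s σ) (h : Stopped P lam s σ) (i : Fin n) :
    (P.removeOld flops lam i s).val = { s with
      B := s.B - (σ i).pick (P.l i (s.j i)) 0 (P.u i (s.j i))
      F := s.F - (σ i).pick 0 (P.b i) 0
      NF := s.NF - (σ i).pick 0 1 0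
      VB := s.VB - (σ i).pick (P.φ (P.lowBp s.j i)) 0 (P.φ (P.highBp s.j i)) } := by
  have h1 := hc.memA i
  have h2 := hc.memB i
  have h3 := h.ltA i
  have h4 := h.ltB i
  cases hi : σ i with
  | low =>
    have := h.geA _ (h1.2 hi)
    simp [removeOld, this]
  | free =>
    have h5 := h3 (by simp [hi])
    have h6 := h.geB _ (h2.2 (by simp [hi]))
    simp [removeOld, h5.not_ge, h6]
  | up =>
    have h5 := h3 (by simp [hi])
    have h6 := h4 hi
    simp [removeOld, h5.not_ge, h6.not_ge]

theorem time_removeOld_le (P : RapDibc n m) (flops : ℕ) (lam : EReal) (i : Fin n)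
    (s : SearchState n m) : (P.removeOld flops lam i s).time ≤ flops + 20 := by
  by_cases h1 : lam ≤ (P.lowBp s.j i : EReal) <;> by_cases h2 : lam ≤ (P.highBp s.j i : EReal) <;>
    simp [removeOld, h1, h2] <;> linarith

/-- The effect of entering activity `i` with status `τ`. -/
structure Added (P : RapDibc n m) (lam : EReal) (i : Fin n) (s r : SearchState n m)
    (τ : Status) : Prop where
  j_eq : r.j = s.j
  B_eq : r.B = s.B + τ.pick (P.l i (s.j i)) 0 (P.u i (s.j i))
  F_eq : r.F = s.F + τ.pick 0 (P.b i) 0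
  NF_eq : r.NF = s.NF + τ.pick 0 1 0
  VB_eq : r.VB = s.VB + τ.pick (P.φ (P.lowBp s.j i)) 0 (P.φ (P.highBp s.j i))
  validA : s.qA.Valid → r.qA.Valid
  validB : s.qB.Valid → r.qB.Valid
  entriesA : (τ = .low ∧ r.qA.entries = (P.lowBp s.j i, i) ::ₘ s.qA.entries) ∨
    (τ ≠ .low ∧ r.qA.entries = s.qA.entries)
  entriesB : (τ ≠ .up ∧ r.qB.entries = (P.highBp s.j i, i) ::ₘ s.qB.entries) ∨
    (τ = .up ∧ r.qB.entries = s.qB.entries)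
  lt_low : τ = .low → lam < (P.lowBp s.j i : EReal)
  low_le : τ ≠ .low → (P.lowBp s.j i : EReal) ≤ lam
  lt_high : τ ≠ .up → lam < (P.highBp s.j i : EReal)
  high_le : τ = .up → (P.highBp s.j i : EReal) ≤ lam

theorem exists_added (P : RapDibc n m) (flops : ℕ) (lam : EReal) (i : Fin n)
    (s : SearchState n m) : ∃ τ, Added P lam i s (P.addNew flops lam i s).val τ := by
  by_cases h1 : lam < (P.lowBp s.j i : EReal)
  · have h2 : lam < (P.highBp s.j i : EReal) :=
      h1.trans_le (EReal.coe_le_coe_iff.2 (P.lowBp_le_highBp s.j i))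
    refine ⟨.low, ?_⟩
    have hv : (P.addNew flops lam i s).val = { s with
        qA := (s.qA.insert (P.lowBp s.j i) i).val
        qB := (s.qB.insert (P.highBp s.j i) i).val
        B := s.B + P.l i (s.j i)
        VB := s.VB + P.φ (P.lowBp s.j i) } := by
      simp [addNew, h1]
    rw [hv]
    exact ⟨rfl, rfl, by simp, by simp, rfl, fun h => h.insert _ _, fun h => h.insert _ _,
      .inl ⟨rfl, BpQueue.entries_insert _ _ _⟩, .inl ⟨by simp, BpQueue.entries_insert _ _ _⟩,
      fun _ => h1, by simp, fun _ => h2, by simp⟩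
  · by_cases h2 : lam < (P.highBp s.j i : EReal)
    · refine ⟨.free, ?_⟩
      have hv : (P.addNew flops lam i s).val = { s with
          qB := (s.qB.insert (P.highBp s.j i) i).val
          F := s.F + P.b i
          NF := s.NF + 1 } := by
        simp [addNew, h1, h2]
      rw [hv]
      exact ⟨rfl, by simp, rfl, rfl, by simp, fun h => h, fun h => h.insert _ _,
        .inr ⟨by simp, rfl⟩, .inl ⟨by simp, BpQueue.entries_insert _ _ _⟩,
        by simp, fun _ => not_lt.1 h1, fun _ => h2, by simp⟩
    · refine ⟨.up, ?_⟩
      have hv : (P.addNew flops lam i s).val = { s with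
          B := s.B + P.u i (s.j i)
          VB := s.VB + P.φ (P.highBp s.j i) } := by
        simp [addNew, h1, h2]
      rw [hv]
      exact ⟨rfl, rfl, by simp, by simp, rfl, fun h => h, fun h => h, .inr ⟨by simp, rfl⟩,
        .inr ⟨rfl, rfl⟩, by simp, fun _ => not_lt.1 h1, by simp, fun _ => not_lt.1 h2⟩

theorem time_addNew_le (P : RapDibc n m) (flops : ℕ) (lam : EReal) (i : Fin n)
    {s : SearchState n m} (hA : s.qA.Valid) (hB : s.qB.Valid) (hA' : s.qA.entries.card ≤ 2 * n)
    (hB' : s.qB.entries.card ≤ 2 * n) :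
    (P.addNew flops lam i s).time ≤ 14 * Nat.log 2 (2 * n + 1) + flops + 40 := by
  have h3 := BpQueue.time_insert_le hA (P.lowBp s.j i) i hA'
  have h4 := BpQueue.time_insert_le hB (P.highBp s.j i) i hB'
  by_cases h1 : lam < (P.lowBp s.j i : EReal) <;> by_cases h2 : lam < (P.highBp s.j i : EReal) <;>
    simp [addNew, h1, h2] <;> linarith

theorem nearest_congr (P : RapDibc n m) {a a' : Fin n → Fin m} {k : Fin n} (lam : EReal)
    (h : a k = a' k) : P.nearest a lam k = P.nearest a' lam k := by
  unfold nearest lowBp highBp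
  rw [h]

/-- The new interval lies entirely to the left of the old one, so the decrease is strict whatever
the multiplier. -/
theorem sum_nearest_update_lt (P : RapDibc n m) {a : Fin n → Fin m} {i : Fin n}
    (hi : a i = P.last) (lam : EReal) :
    ∑ k, P.nearest (Function.update a i P.penult) lam k < ∑ k, P.nearest a lam k := by
  rw [Fintype.sum_eq_sub_add i (f := P.nearest a lam)]
  · have h1 := (P.nearest_mem (Function.update a i P.penult) lam i).2
    have h2 := (P.nearest_mem a lam i).1
    have h3 := P.u_lt_l i _ _ P.penult_lt_last
    rw [Function.update_self] at h1
    rw [hi] at h2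
    linarith
  · intro k hk
    exact P.nearest_congr lam (Function.update_of_ne hk _ _).symm

theorem Outcome.sum_nearest_le {P : RapDibc n m} {a : Fin n → Fin m} {lam V : EReal}
    (h : P.Outcome a lam V) : lam = ⊥ ∨ ∑ k, P.nearest a lam k ≤ P.R := by
  rcases h with ⟨t, rfl, h1, -⟩ | ⟨rfl, -, -⟩ | ⟨rfl, -, h1⟩
  · exact .inr h1.le
  · exact .inl rfl
  · refine .inr ?_
    simp only [nearest_top]
    exact h1.le

/-- A delivered state becomes a legitimate starting state for the next partition vector. Old entries
of the moved activity may stay, since their keys belong to the last interval and differ from the new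
ones. -/
theorem move_spec {P : RapDibc n m} {lam V : EReal} {s t r : SearchState n m}
    {σ : Fin n → Status} {τ : Status} (hc : Consistent P s σ) (h : Stopped P lam s σ)
    (ho : P.Outcome s.j lam V) {i : Fin n} (hi : s.j i = P.last)
    (ht : t = { s with
      j := Function.update s.j i P.penult
      B := s.B - (σ i).pick (P.l i (s.j i)) 0 (P.u i (s.j i))
      F := s.F - (σ i).pick 0 (P.b i) 0
      NF := s.NF - (σ i).pick 0 1 0
      VB := s.VB - (σ i).pick (P.φ (P.lowBp s.j i)) 0 (P.φ (P.highBp s.j i)) })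
    (hr : Added P lam i t r τ) :
    Consistent P r (Function.update σ i τ) ∧ Searching P lam r (Function.update σ i τ) ∧
      r.j = Function.update s.j i P.penult ∧ queueSize r ≤ queueSize s + 2 := by
  have htj : t.j = Function.update s.j i P.penult := by rw [ht]
  have htA : t.qA = s.qA := by rw [ht]
  have htB : t.qB = s.qB := by rw [ht]
  have hrj : r.j = Function.update s.j i P.penult := hr.j_eq.trans htj
  have hji : t.j i = P.penult := by rw [htj, Function.update_self]
  have hne : ∀ k, k ≠ i → Function.update σ i τ k = σ k := fun k hk =>
    Function.update_of_ne hk _ _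
  have hjne : ∀ k, k ≠ i → t.j k = s.j k := fun k hk => by
    rw [htj, Function.update_of_ne hk]
  have hlow : ∀ k, k ≠ i → P.lowBp t.j k = P.lowBp s.j k := fun k hk => by
    simp only [lowBp, hjne k hk]
  have hhigh : ∀ k, k ≠ i → P.highBp t.j k = P.highBp s.j k := fun k hk => by
    simp only [highBp, hjne k hk]
  -- Outdated entries are recognized by their key alone, which requires the new key to differ from
  -- the old one.
  have hlow_ne : P.lowBp t.j i ≠ P.l i P.last + P.b i := by
    have := P.l_lt_l i P.penult_lt_last
    simp only [lowBp, hji]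
    intro h'
    linarith
  have hhigh_ne : P.highBp t.j i ≠ P.u i P.last + P.b i := by
    have := P.u_lt_u i P.penult_lt_last
    simp only [highBp, hji]
    intro h'
    linarith
  have hnotA : (P.lowBp t.j i, i) ∉ s.qA.entries := fun h' => by
    rcases hc.entryA _ h' with h'' | h''
    · simp only [lowBp, hi] at h''
      exact hlow_ne h''
    · exact hlow_ne h''
  have hnotB : (P.highBp t.j i, i) ∉ s.qB.entries := fun h' => by
    rcases hc.entryB _ h' with h'' | h''
    · simp only [highBp, hi] at h''
      exact hhigh_ne h''
    · exact hhigh_ne h''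
  have hentA : ∀ e ∈ s.qA.entries,
      e.1 = P.lowBp t.j e.2 ∨ e.1 = P.l e.2 P.last + P.b e.2 := fun e he => by
    rcases hc.entryA e he with h' | h'
    · by_cases hk : e.2 = i
      · refine .inr ?_
        rw [h', lowBp, hk, hi]
      · exact .inl (by rw [h', hlow _ hk])
    · exact .inr h'
  have hentB : ∀ e ∈ s.qB.entries,
      e.1 = P.highBp t.j e.2 ∨ e.1 = P.u e.2 P.last + P.b e.2 := fun e he => by
    rcases hc.entryB e he with h' | h'
    · by_cases hk : e.2 = i
      · refine .inr ?_
        rw [h', highBp, hk, hi]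
      · exact .inl (by rw [h', hhigh _ hk])
    · exact .inr h'
  have hEA := hr.entriesA
  have hEB := hr.entriesB
  rw [htA] at hEA
  rw [htB] at hEB
  have hmemA : ∀ e, e ∈ r.qA.entries ↔ (τ = .low ∧ e = (P.lowBp t.j i, i)) ∨ e ∈ s.qA.entries := by
    intro e
    rcases hEA with ⟨h1, h2⟩ | ⟨h1, h2⟩ <;> simp [h1, h2]
  have hmemB : ∀ e, e ∈ r.qB.entries ↔ (τ ≠ .up ∧ e = (P.highBp t.j i, i)) ∨ e ∈ s.qB.entries := by
    intro e
    rcases hEB with ⟨h1, h2⟩ | ⟨h1, h2⟩ <;> simp [h1, h2]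
  refine ⟨?_, ?_, hrj, ?_⟩
  · exact {
      validA := hr.validA (htA ▸ hc.validA)
      validB := hr.validB (htB ▸ hc.validB)
      nodupA := by
        rcases hEA with ⟨h1, h2⟩ | ⟨h1, h2⟩
        · rw [h2, Multiset.nodup_cons]
          exact ⟨hnotA, hc.nodupA⟩
        · rw [h2]
          exact hc.nodupA
      nodupB := by
        rcases hEB with ⟨h1, h2⟩ | ⟨h1, h2⟩
        · rw [h2, Multiset.nodup_cons]
          exact ⟨hnotB, hc.nodupB⟩
        · rw [h2]
          exact hc.nodupB
      entryA := fun e he => by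
        rw [hr.j_eq]
        rcases (hmemA e).1 he with ⟨-, rfl⟩ | he
        · exact .inl rfl
        · exact hentA e he
      entryB := fun e he => by
        rw [hr.j_eq]
        rcases (hmemB e).1 he with ⟨-, rfl⟩ | he
        · exact .inl rfl
        · exact hentB e he
      memA := fun k => by
        rw [hr.j_eq, hmemA]
        by_cases hk : k = i
        · subst hk
          simp [hnotA]
        · rw [hne k hk, hlow k hk, ← hc.memA k]
          simp [hk]
      memB := fun k => by
        rw [hr.j_eq, hmemB]
        by_cases hk : k = i
        · subst hk
          simp [hnotB]
        · rw [hne k hk, hhigh k hk, ← hc.memB k]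
          simp [hk]
      B_eq := by
        rw [hr.j_eq, hr.B_eq, Fintype.sum_eq_sub_add i
          (f := fun k => (σ k).pick (P.l k (s.j k)) 0 (P.u k (s.j k)))
          fun k hk => by rw [hne k hk, hjne k hk], Function.update_self, ht, hc.B_eq]
      F_eq := by
        rw [hr.F_eq, Fintype.sum_eq_sub_add i
          (f := fun k => (σ k).pick 0 (P.b k) 0)
          fun k hk => by rw [hne k hk], Function.update_self, ht, hc.F_eq]
      NF_eq := by
        rw [hr.NF_eq, Fintype.sum_eq_sub_add i
          (f := fun k => (σ k).pick 0 1 0)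
          fun k hk => by rw [hne k hk], Function.update_self, ht, hc.NF_eq]
      VB_eq := by
        rw [hr.j_eq, hr.VB_eq, Fintype.sum_eq_sub_add i
          (f := fun k => (σ k).pick (P.φ (P.lowBp s.j k)) 0 (P.φ (P.highBp s.j k)))
          fun k hk => by rw [hne k hk, hlow k hk, hhigh k hk], Function.update_self, ht,
          hc.VB_eq] }
  · exact {
      geA := fun e he => by
        rcases (hmemA e).1 he with ⟨h1, rfl⟩ | he
        · exact (hr.lt_low h1).le
        · exact h.geA e he
      geB := fun e he => by
        rcases (hmemB e).1 he with ⟨h1, rfl⟩ | he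
        · exact (hr.lt_high h1).le
        · exact h.geB e he
      leA := fun k hk => by
        rw [hr.j_eq]
        by_cases hki : k = i
        · subst hki
          rw [Function.update_self] at hk
          exact hr.low_le hk
        · rw [hne k hki] at hk
          rw [hlow k hki]
          exact (h.ltA k hk).le
      leB := fun k hk => by
        rw [hr.j_eq]
        by_cases hki : k = i
        · subst hki
          rw [Function.update_self] at hk
          exact hr.high_le hk
        · rw [hne k hki] at hk
          rw [hhigh k hki]
          exact (h.ltB k hk).le
      below := by
        -- After the outcome ⊥ the search is still at its very beginning; otherwise the sum was at
        -- most R and has strictly dropped.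
        refine ho.sum_nearest_le.imp id fun h1 => ?_
        rw [hrj]
        exact (P.sum_nearest_update_lt hi lam).trans_le h1 }
  · have h1 : r.qA.entries.card ≤ s.qA.entries.card + 1 := by
      rcases hEA with ⟨h1, h2⟩ | ⟨h1, h2⟩ <;> simp [h2]
    have h2 : r.qB.entries.card ≤ s.qB.entries.card + 1 := by
      rcases hEB with ⟨h1, h2⟩ | ⟨h1, h2⟩ <;> simp [h2]
    rw [queueSize, queueSize]
    omega

theorem setUp_spec (P : RapDibc n m) (flops : ℕ) (f : Fin n → Fin m) (is : List (Fin n))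
    (s : SearchState n m) (hA : s.qA.Valid) (hB : s.qB.Valid)
    (hcA : s.qA.entries.card + is.length ≤ 2 * n) (hcB : s.qB.entries.card + is.length ≤ 2 * n) :
    ∃ r, (P.setUp flops is (is.map f) s).val = r ∧ r.qA.Valid ∧ r.qB.Valid ∧
      r.qA.entries = ((is.map fun i => (P.lowBp f i, i) : List (ℝ × Fin n)) :
        Multiset (ℝ × Fin n)) + s.qA.entries ∧
      r.qB.entries = ((is.map fun i => (P.highBp f i, i) : List (ℝ × Fin n)) :
        Multiset (ℝ × Fin n)) + s.qB.entries ∧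
      r.j = (fun i => if i ∈ is then f i else s.j i) ∧
      r.B = s.B + (is.map fun i => P.l i (f i)).sum ∧ r.F = s.F ∧ r.NF = s.NF ∧
      r.VB = s.VB + (is.map fun i => P.φ (P.lowBp f i)).sum ∧
      (P.setUp flops is (is.map f) s).time ≤
        is.length * (14 * Nat.log 2 (2 * n + 1) + flops + 40) := by
  induction is generalizing s with
  | nil => exact ⟨_, rfl, by simp [setUp, hA, hB]⟩
  | cons i is ih =>
    simp only [List.length_cons] at hcA hcB
    have htA := BpQueue.time_insert_le hA (P.lowBp f i) i (N := 2 * n) (by omega)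
    have htB := BpQueue.time_insert_le hB (P.highBp f i) i (N := 2 * n) (by omega)
    have hlow : P.lowBp (Function.update s.j i (f i)) i = P.lowBp f i := by simp [lowBp]
    have hhigh : P.highBp (Function.update s.j i (f i)) i = P.highBp f i := by simp [highBp]
    obtain ⟨r, hr, h1, h2, h3, h4, h5, h6, h7, h8, h9, h10⟩ := ih
      { qA := (s.qA.insert (P.lowBp f i) i).val
        qB := (s.qB.insert (P.highBp f i) i).val
        j := Function.update s.j i (f i)
        B := s.B + P.l i (f i)
        F := s.F
        NF := s.NF
        VB := s.VB + P.φ (P.lowBp f i) } (hA.insert _ _) (hB.insert _ _)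
      (by simp only [BpQueue.entries_insert, Multiset.card_cons]; omega)
      (by simp only [BpQueue.entries_insert, Multiset.card_cons]; omega)
    refine ⟨r, ?_, h1, h2, ?_, ?_, ?_, ?_, h7, h8, ?_, ?_⟩
    · simpa [setUp, hlow, hhigh] using hr
    · rw [h3, BpQueue.entries_insert, List.map_cons, ← Multiset.cons_coe, Multiset.cons_add,
        Multiset.add_cons]
    · rw [h4, BpQueue.entries_insert, List.map_cons, ← Multiset.cons_coe, Multiset.cons_add,
        Multiset.add_cons]
    · rw [h5]
      funext k
      by_cases hk : k = i
      · subst hk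
        simp
      · simp [hk]
    · rw [h6, List.map_cons, List.sum_cons, add_assoc]
    · rw [h9, List.map_cons, List.sum_cons, add_assoc]
    · simp only [List.map_cons, setUp, time_bind, time_tick, Timed.write, val_op, time_op,
        val_lower, time_lower, val_alpha, time_alpha, val_beta, time_beta, Timed.add, val_evalPhi,
        time_evalPhi, hlow, hhigh, Function.update_self, List.length_cons, add_mul, one_mul] at h10 ⊢
      linarith

/-! ### One sweep over all values of the last partition entry -/

/-- The assignment of the partition vector `(K', K)`, where `f` is that of `(K', K_{m-2})`. -/
def assignment (P : RapDibc n m) (f : Fin n → Fin m) (K : ℕ) (i : Fin n) : Fin m :=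
  if f i = P.last ∧ (i : ℕ) < K then P.penult else f i

theorem assignment_succ (P : RapDibc n m) {f : Fin n → Fin m} {K : ℕ} {i : Fin n}
    (hi : (i : ℕ) = K) (hf : f i = P.last) :
    P.assignment f (K + 1) = Function.update (P.assignment f K) i P.penult := by
  funext k
  by_cases hk : k = i
  · subst hk
    simp [assignment, hf, hi]
  · have hk' : (k : ℕ) ≠ K := fun h => hk (Fin.ext (h.trans hi.symm))
    rw [Function.update_of_ne hk, assignment, assignment]
    congr 2
    rw [eq_iff_iff, Nat.lt_succ_iff_lt_or_eq]
    simp [hk']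

/-- A candidate has no solution yet, or it describes an optimal solution of a subproblem. -/
def Sound (P : RapDibc n m) (c : Candidate m) : Prop :=
  c.V = ⊤ ∨ ∃ (f : Fin n → Fin m) (t : ℝ), c.sub = (List.finRange n).map f ∧ c.lam = t ∧
    ∑ i, P.nearest (P.assignment f c.K) t i = P.R ∧
    c.V = (P.objective (P.nearest (P.assignment f c.K) t) : EReal)

/-- The better one of two candidates. -/
noncomputable def better (best c : Candidate m) : Candidate m := if c.V < best.V then c else best

theorem better_V_le_left (best c : Candidate m) : (better best c).V ≤ best.V := by
  rw [better]
  split_ifs with h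
  · exact h.le
  · exact le_rfl

theorem better_V_le_right (best c : Candidate m) : (better best c).V ≤ c.V := by
  rw [better]
  split_ifs with h
  · exact le_rfl
  · exact not_lt.1 h

theorem Sound.better {P : RapDibc n m} {best : Candidate m} (h : P.Sound best) {f : Fin n → Fin m}
    {lam V : EReal} {K : ℕ} (ho : P.Outcome (P.assignment f K) lam V) :
    P.Sound (better best { V := V, lam := lam, sub := (List.finRange n).map f, K := K }) := by
  rw [RapDibc.better]
  split_ifs
  · rcases ho with ⟨t, h1, h2, h3⟩ | ⟨-, h1, -⟩ | ⟨-, h1, -⟩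
    · exact .inr ⟨f, t, rfl, h1, h2, h3⟩
    · exact .inl h1
    · exact .inl h1
  · exact h

section

variable (P : RapDibc n m) (flops : ℕ) (sub : List (Fin m)) (K : ℕ) {s s' : SearchState n m}
  (best : Candidate m) {lam V : EReal} (hv : (P.search flops s).val = (s', some (lam, V)))

include hv

theorem val_sweep_nil : (P.sweep flops sub [] K s best).val =
    better best { V := V, lam := lam, sub := sub, K := K } := by
  rw [sweep]
  simp [hv, better]

theorem time_sweep_nil : (P.sweep flops sub [] K s best).time = (P.search flops s).time + 3 := by
  rw [sweep]
  simp [hv]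
  ring

theorem val_sweep_cons (i : Fin n) (rest : List (Fin n)) {t : SearchState n m}
    (ht : t = { (P.removeOld flops lam i s').val with
      j := Function.update (P.removeOld flops lam i s').val.j i P.penult }) :
    (P.sweep flops sub (i :: rest) K s best).val =
      (P.sweep flops sub rest (K + 1) (P.addNew flops lam i t).val
        (better best { V := V, lam := lam, sub := sub, K := K })).val := by
  subst ht
  rw [sweep]
  simp [hv, better]

theorem time_sweep_cons (i : Fin n) (rest : List (Fin n)) {t : SearchState n m}
    (ht : t = { (P.removeOld flops lam i s').val with
      j := Function.update (P.removeOld flops lam i s').val.j i P.penult }) :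
    (P.sweep flops sub (i :: rest) K s best).time =
      (P.search flops s).time + (P.removeOld flops lam i s').time + (P.addNew flops lam i t).time +
      (P.sweep flops sub rest (K + 1) (P.addNew flops lam i t).val
        (better best { V := V, lam := lam, sub := sub, K := K })).time + 5 := by
  subst ht
  rw [sweep]
  simp [hv, better]
  ring

end

/-- The queue size is the potential. Per remaining activity, five units pay for the delivering
iteration (1), the two update rounds with overhead (2) and the two breakpoints that may be inserted
(2). -/
theorem sweep_spec (hn : 0 < n) {P : RapDibc n m} (flops : ℕ) {f : Fin n → Fin m}
    (rest : List (Fin n)) {K : ℕ} {L : EReal} {s : SearchState n m} {σ : Fin n → Status}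
    {best : Candidate m} (hc : Consistent P s σ) (h : Searching P L s σ)
    (hj : s.j = P.assignment f K) (hrest : rest = (List.finRange n).drop K)
    (hf : ∀ i : Fin n, K ≤ i → f i = P.last) (hbest : P.Sound best) :
    P.Sound (P.sweep flops ((List.finRange n).map f) rest K s best).val ∧
    (P.sweep flops ((List.finRange n).map f) rest K s best).val.V ≤ best.V ∧
    (∀ K', K ≤ K' → K' ≤ n → ∀ y, P.FeasibleFor (P.assignment f K') y →
      (P.sweep flops ((List.finRange n).map f) rest K s best).val.V ≤ (P.objective y : EReal)) ∧
    (P.sweep flops ((List.finRange n).map f) rest K s best).time ≤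
      (queueSize s + 5 * (rest.length + 1)) * (14 * Nat.log 2 (2 * n + 1) + flops + 41) := by
  induction rest generalizing K L s σ best with
  | nil =>
    obtain ⟨s', σ', lam, V, hv, hc', hst, ho, hj', hq, ht⟩ := search_spec hn flops hc h
    have hnK : n ≤ K := by simpa using hrest.symm
    rw [hj'.trans hj] at ho
    rw [val_sweep_nil P flops _ K best hv, time_sweep_nil P flops _ K best hv]
    refine ⟨hbest.better ho, better_V_le_left _ _, fun K' hK hK' y hy => ?_, ?_⟩
    · obtain rfl : K = K' := by omega
      exact (better_V_le_right _ _).trans (ho.le_objective hy)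
    · set W := 14 * Nat.log 2 (2 * n + 1) + flops + 41 with hW
      have h1 : (queueSize s - queueSize s' + 1) * W ≤ (queueSize s + 1) * W :=
        Nat.mul_le_mul_right _ (by omega)
      have h2 : 41 ≤ W := by omega
      simp only [List.length_nil]
      linarith
  | cons i rest ih =>
    obtain ⟨s', σ', lam, V, hv, hc', hst, ho, hj', hq, ht⟩ := search_spec hn flops hc h
    have hKn : K < n := by
      by_contra hK
      rw [List.drop_eq_nil_of_le (by simpa using hK)] at hrest
      exact List.cons_ne_nil _ _ hrest
    rw [List.drop_eq_getElem_cons (by simpa using hKn), List.cons.injEq] at hrest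
    obtain ⟨hi, hrest⟩ := hrest
    have hiK : (i : ℕ) = K := by simp [hi]
    have hfi := hf i hiK.ge
    have hsj : s'.j = P.assignment f K := hj'.trans hj
    have hsi : s'.j i = P.last := by
      rw [hsj, assignment, hfi]
      simp [hiK]
    set t : SearchState n m := { (P.removeOld flops lam i s').val with
      j := Function.update (P.removeOld flops lam i s').val.j i P.penult } with ht'
    obtain ⟨τ, hτ⟩ := P.exists_added flops lam i t
    obtain ⟨hc₂, h₂, hj₂, hq₂⟩ := move_spec hc' hst ho hsi
      (by rw [ht', val_removeOld flops hc' hst]) hτ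
    have hb := hbest.better (hsj ▸ ho)
    obtain ⟨i1, i2, i3, i4⟩ := ih hc₂ h₂ (by rw [hj₂, hsj, P.assignment_succ hiK hfi]) hrest
      (fun k hk => hf k (by omega)) hb
    rw [val_sweep_cons P flops _ K best hv i rest ht', time_sweep_cons P flops _ K best hv i rest ht']
    refine ⟨i1, i2.trans (better_V_le_left _ _), fun K' hK hK' y hy => ?_, ?_⟩
    · rcases hK.eq_or_lt with rfl | hK
      · exact (i2.trans (better_V_le_right _ _)).trans (Outcome.le_objective (hsj ▸ ho) hy)
      · exact i3 K' hK hK' y hy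
    · have htA : t.qA = s'.qA := by rw [ht', val_removeOld flops hc' hst]
      have htB : t.qB = s'.qB := by rw [ht', val_removeOld flops hc' hst]
      have t1 := P.time_removeOld_le flops lam i s'
      have t2 := P.time_addNew_le flops lam i (s := t) (htA ▸ hc'.validA) (htB ▸ hc'.validB)
        (htA ▸ hc'.cardA_le) (htB ▸ hc'.cardB_le)
      rw [List.length_cons]
      set W := 14 * Nat.log 2 (2 * n + 1) + flops + 41 with hW
      have h3 := Nat.mul_le_mul_right W hq₂
      obtain ⟨d, hd⟩ := Nat.exists_eq_add_of_le hq
      rw [hd, Nat.add_sub_cancel_left] at ht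
      rw [hd]
      have h4 : 41 + flops ≤ W := by omega
      generalize queueSize (P.addNew flops lam i t).val = q at *
      nlinarith

/-! ### Enumerating and counting the subpartition vectors -/

@[simp] theorem val_consAll (c : Fin m) (xs : List (List (Fin m))) :
    (consAll c xs).val = xs.map (c :: ·) := by
  induction xs with
  | nil => rfl
  | cons x xs ih => simp [consAll, ih]

theorem time_consAll (c : Fin m) (xs : List (List (Fin m))) :
    (consAll c xs).time = xs.length + 1 := by
  induction xs with
  | nil => rfl
  | cons x xs ih => simp [consAll, ih]

@[simp] theorem val_appendT (xs ys : List (List (Fin m))) : (appendT xs ys).val = xs ++ ys := by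
  induction xs with
  | nil => rfl
  | cons x xs ih => simp [appendT, ih]

theorem time_appendT (xs ys : List (List (Fin m))) : (appendT xs ys).time = xs.length + 1 := by
  induction xs with
  | nil => rfl
  | cons x xs ih => simp [appendT, ih]

theorem mem_monotoneSeqs (k : ℕ) (cs : List (Fin m)) (hcs : cs.Pairwise (· < ·))
    (xs : List (Fin m)) : xs ∈ (monotoneSeqs k cs).val ↔
      xs.length = k ∧ xs.Pairwise (· ≤ ·) ∧ ∀ x ∈ xs, x ∈ cs := by
  fun_induction monotoneSeqs k cs generalizing xs with
  | case1 cs =>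
    simp only [val_op, List.mem_singleton, List.length_eq_zero_iff]
    constructor
    · rintro rfl
      simp
    · exact fun h => h.1
  | case2 k =>
    simp only [val_op, List.not_mem_nil, false_iff]
    rintro ⟨h1, -, h2⟩
    cases xs with
    | nil => simp at h1
    | cons x xs => exact h2 x List.mem_cons_self
  | case3 k c cs ih1 ih2 =>
    rw [List.pairwise_cons] at hcs
    simp only [val_bind, val_appendT, val_consAll, List.mem_append, List.mem_map,
      ih1 (List.pairwise_cons.2 hcs), ih2 hcs.2]
    constructor
    · rintro (⟨ys, ⟨h1, h2, h3⟩, rfl⟩ | ⟨h1, h2, h3⟩)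
      · refine ⟨by simp [h1], List.pairwise_cons.2 ⟨fun y hy => ?_, h2⟩, fun x hx => ?_⟩
        · rcases List.mem_cons.1 (h3 y hy) with rfl | h
          · exact le_rfl
          · exact (hcs.1 y h).le
        · rcases List.mem_cons.1 hx with rfl | h
          · exact List.mem_cons_self
          · exact h3 x h
      · exact ⟨h1, h2, fun x hx => List.mem_cons_of_mem _ (h3 x hx)⟩
    · rintro ⟨h1, h2, h3⟩
      cases xs with
      | nil => simp at h1
      | cons x ys =>
        rw [List.pairwise_cons] at h2
        by_cases hx : x = c
        · subst hx
          exact .inl ⟨ys, ⟨by simpa using h1, h2.2, fun y hy => h3 y (List.mem_cons_of_mem _ hy)⟩,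
            rfl⟩
        · have hx' : x ∈ cs := (List.mem_cons.1 (h3 x List.mem_cons_self)).resolve_left hx
          refine .inr ⟨h1, List.pairwise_cons.2 h2, fun y hy => ?_⟩
          refine (List.mem_cons.1 (h3 y hy)).resolve_left fun hyc => ?_
          rcases List.mem_cons.1 hy with rfl | hy
          · exact hx hyc
          · exact absurd (hcs.1 x hx') (not_lt.2 (hyc ▸ h2.1 y hy))

theorem length_monotoneSeqs (k : ℕ) (cs : List (Fin m)) :
    (monotoneSeqs k cs).val.length = Nat.multichoose cs.length k := by
  fun_induction monotoneSeqs k cs with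
  | case1 cs => simp
  | case2 k => simp
  | case3 k c cs ih1 ih2 =>
    simp only [val_bind, val_appendT, val_consAll, List.length_append, List.length_map, ih1, ih2,
      List.length_cons, Nat.multichoose_succ_succ]
    ring

/-- The second binomial term counts the leaves of the recursion; the first accounts for prefixing
and concatenating. With the additional 2 on the left, the recurrence reproduces the bound exactly.
-/
theorem time_monotoneSeqs_le (k : ℕ) (cs : List (Fin m)) :
    (monotoneSeqs k cs).time + 2 ≤ 2 * k * Nat.multichoose cs.length k +
      3 * Nat.multichoose (cs.length + 1) k := by
  fun_induction monotoneSeqs k cs with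
  | case1 cs => simp
  | case2 k => simp
  | case3 k c cs ih1 ih2 =>
    simp only [time_bind, time_consAll, time_appendT, val_consAll, List.length_map,
      length_monotoneSeqs, List.length_cons] at ih1 ih2 ⊢
    rw [Nat.multichoose_succ_succ cs.length k, Nat.multichoose_succ_succ (cs.length + 1) k]
    ring_nf at ih1 ih2 ⊢
    linarith

end RapDibc

theorem Nat.multichoose_le_succ_right {c : ℕ} (hc : 0 < c) (k : ℕ) :
    Nat.multichoose c k ≤ Nat.multichoose c (k + 1) := by
  obtain ⟨c, rfl⟩ := Nat.exists_eq_succ_of_ne_zero hc.ne'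
  rw [Nat.succ_eq_add_one, Nat.multichoose_succ_succ]
  exact Nat.le_add_left _ _

/-- The left side is the sum of `Nat.multichoose c j` over j ≤ k, and its last term is the largest.
-/
theorem Nat.multichoose_succ_left_le {c : ℕ} (hc : 0 < c) (k : ℕ) :
    Nat.multichoose (c + 1) k ≤ (k + 1) * Nat.multichoose c k := by
  induction k with
  | zero => simp
  | succ k ih =>
    rw [Nat.multichoose_succ_succ]
    have := Nat.multichoose_le_succ_right hc k
    nlinarith

theorem Nat.le_multichoose {c k : ℕ} (hc : 0 < c) (hk : 0 < k) : c ≤ Nat.multichoose c k := by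
  obtain ⟨k, rfl⟩ := Nat.exists_eq_succ_of_ne_zero hk.ne'
  induction k with
  | zero => simp
  | succ k ih => exact (ih k.succ_pos).trans (Nat.multichoose_le_succ_right hc _)

namespace RapDibc

open Timed

variable {n m : ℕ}

/-- Equality of the last two entries of a partition vector means that the last but one interval is
empty, so the vectors correspond to the non-decreasing maps that avoid it. -/
theorem mem_subpartitions (P : RapDibc n m) (xs : List (Fin m)) :
    xs ∈ P.subpartitions.val ↔
      ∃ f : Fin n → Fin m, Monotone f ∧ (∀ i, f i ≠ P.penult) ∧ xs = (List.finRange n).map f := by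
  have hs : ((List.finRange m).filter fun j => j ≠ P.penult).Pairwise (· < ·) :=
    (List.pairwise_lt_finRange m).filter _
  simp only [subpartitions, val_bind, mem_monotoneSeqs n _ hs]
  constructor
  · rintro ⟨h1, h2, h3⟩
    subst h1
    refine ⟨xs.get, ?_, fun i => ?_, (List.map_get_finRange xs).symm⟩
    · exact fun i j hij => (List.sortedLE_iff_pairwise.2 h2).monotone_get hij
    · simpa using h3 _ (xs.get_mem i)
  · rintro ⟨f, h1, h2, rfl⟩
    refine ⟨by simp, ?_, ?_⟩
    · rw [List.pairwise_map]
      exact (List.pairwise_le_finRange n).imp fun h => h1 h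
    · simpa using h2

theorem length_intervals (P : RapDibc n m) :
    ((List.finRange m).filter fun j => j ≠ P.penult).length = m - 1 := by
  have h := List.length_erase_of_mem (List.mem_finRange P.penult)
  rw [(List.nodup_finRange m).erase_eq_filter] at h
  rw [List.length_finRange] at h
  rw [← h]
  congr 2
  funext j
  by_cases hj : j = P.penult <;> simp [hj]

theorem length_subpartitions (P : RapDibc n m) :
    P.subpartitions.val.length = (n + m - 2).choose (m - 2) := by
  have h2 := P.two_le
  simp only [subpartitions, val_bind, length_monotoneSeqs, length_intervals, Nat.multichoose_eq]
  rw [show m - 1 + n - 1 = n + m - 2 by omega, ← Nat.choose_symm (by omega)]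
  congr 1
  omega

theorem time_subpartitions_le (hn : 0 < n) (P : RapDibc n m) :
    P.subpartitions.time ≤ 10 * (n * (n + m - 2).choose (m - 2)) := by
  have h2 := P.two_le
  have h0 : Nat.multichoose (m - 1) n = (n + m - 2).choose (m - 2) := by
    rw [← P.length_subpartitions]
    simp only [subpartitions, val_bind, length_monotoneSeqs, length_intervals]
  have h1 := time_monotoneSeqs_le n ((List.finRange m).filter fun j => j ≠ P.penult)
  rw [P.length_intervals] at h1
  have h3 := Nat.multichoose_succ_left_le (c := m - 1) (by omega) n
  have h4 := Nat.le_multichoose (c := m - 1) (by omega) hn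
  simp only [subpartitions, time_bind, time_tick]
  rw [← h0]
  -- The count is at least m - 1, hence at least m / 2; this absorbs the m ticks for listing the
  -- intervals.
  have h5 : m ≤ 2 * Nat.multichoose (m - 1) n := by omega
  have h6 : Nat.multichoose (m - 1) n ≤ n * Nat.multichoose (m - 1) n := Nat.le_mul_of_pos_left _ hn
  nlinarith

/-! ### From sweeps to the whole algorithm -/

theorem val_countSub_map (P : RapDibc n m) (f : Fin n → Fin m) (is : List (Fin n)) :
    (P.countSub (is.map f)).val = is.countP fun i => f i ≠ P.last := by
  induction is with
  | nil => rfl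
  | cons i is ih =>
    by_cases h : f i = P.last
    · simp [countSub, h, ih]
    · simp [countSub, h, ih]

theorem time_countSub (P : RapDibc n m) (cs : List (Fin m)) :
    (P.countSub cs).time = 2 * cs.length + 1 := by
  induction cs with
  | nil => rfl
  | cons c cs ih =>
    by_cases h : c = P.last
    · simp [countSub, h, ih]
      ring
    · simp [countSub, h, ih]
      ring

theorem countP_finRange_eq_card (p : Fin n → Prop) [DecidablePred p] :
    (List.finRange n).countP (fun i => p i) = (Finset.univ.filter p).card := by
  rw [List.countP_eq_length_filter]
  rfl

/-- For a non-decreasing map the activities outside the last interval form an initial segment, so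
their number is the index at which the last interval begins. -/
theorem countSub_le_iff (P : RapDibc n m) {f : Fin n → Fin m} (hf : Monotone f) (i : Fin n) :
    (P.countSub ((List.finRange n).map f)).val ≤ i ↔ f i = P.last := by
  rw [val_countSub_map, countP_finRange_eq_card]
  constructor
  · intro h
    by_contra hi
    have hsub : Finset.Iic i ⊆ Finset.univ.filter fun k => f k ≠ P.last := fun k hk => by
      rw [Finset.mem_Iic] at hk
      simp only [Finset.mem_filter, Finset.mem_univ, true_and]
      exact fun hk' => hi (le_antisymm (P.le_last _) (hk' ▸ hf hk))
    have := Finset.card_le_card hsub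
    rw [Fin.card_Iic] at this
    omega
  · intro hi
    have hsub : (Finset.univ.filter fun k => f k ≠ P.last) ⊆ Finset.Iio i := fun k hk => by
      rw [Finset.mem_Iio]
      by_contra hk'
      simp only [Finset.mem_filter, Finset.mem_univ, true_and] at hk
      exact hk (le_antisymm (P.le_last _) (hi ▸ hf (not_lt.1 hk')))
    have := Finset.card_le_card hsub
    rwa [Fin.card_Iio] at this

theorem reconstruct_cons_val (P : RapDibc n m) (lam : ℝ) (K : ℕ) (f : Fin n → Fin m) (i : Fin n)
    (is : List (Fin n)) (cs : List (Fin m)) (x : Fin n → ℝ) :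
    (P.reconstruct lam K (i :: is) (f i :: cs) x).val =
      (P.reconstruct lam K is cs
        (Function.update x i (P.nearest (P.assignment f K) lam i))).val := by
  have ha : (if f i = P.last ∧ (i : ℕ) < K then P.penult else f i) = P.assignment f K i := rfl
  rw [nearest_coe, lowBp, highBp]
  simp only [reconstruct, val_bind, Timed.eq, Timed.lt, Timed.add, Timed.sub, Timed.le, Timed.write,
    val_op, Bool.and_eq_true, decide_eq_true_eq, ha]
  rcases Classical.propComplete (lam ≤ P.l i (P.assignment f K i) + P.b i) with c1 | c1 <;>
    rcases Classical.propComplete (P.u i (P.assignment f K i) + P.b i ≤ lam) with c2 | c2 <;>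
    simp only [c1, c2, decide_true, decide_false, if_true, if_false, Bool.false_eq_true]

theorem reconstruct_cons_time (P : RapDibc n m) (lam : ℝ) (K : ℕ) (f : Fin n → Fin m) (i : Fin n)
    (is : List (Fin n)) (cs : List (Fin m)) (x : Fin n → ℝ) :
    (P.reconstruct lam K (i :: is) (f i :: cs) x).time =
      (P.reconstruct lam K is cs
        (Function.update x i (P.nearest (P.assignment f K) lam i))).time + 13 := by
  have ha : (if f i = P.last ∧ (i : ℕ) < K then P.penult else f i) = P.assignment f K i := rfl
  rw [nearest_coe, lowBp, highBp]
  simp only [reconstruct, time_bind, Timed.eq, Timed.lt, Timed.add, Timed.sub, Timed.le,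
    Timed.write, val_op, time_op, time_tick, Bool.and_eq_true, decide_eq_true_eq, ha]
  rcases Classical.propComplete (lam ≤ P.l i (P.assignment f K i) + P.b i) with c1 | c1 <;>
    rcases Classical.propComplete (P.u i (P.assignment f K i) + P.b i ≤ lam) with c2 | c2 <;>
    simp only [c1, c2, decide_true, decide_false, if_true, if_false, Bool.false_eq_true] <;>
    ring

theorem reconstruct_spec (P : RapDibc n m) (lam : ℝ) (K : ℕ) (f : Fin n → Fin m)
    (is : List (Fin n)) (x : Fin n → ℝ) :
    (P.reconstruct lam K is (is.map f) x).val =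
      (fun k => if k ∈ is then P.nearest (P.assignment f K) lam k else x k) ∧
    (P.reconstruct lam K is (is.map f) x).time = 13 * is.length := by
  induction is generalizing x with
  | nil => simp [reconstruct]
  | cons i is ih =>
    obtain ⟨h1, h2⟩ := ih (Function.update x i (P.nearest (P.assignment f K) lam i))
    have h3 : (fun k => if k ∈ i :: is then P.nearest (P.assignment f K) lam k else x k) =
        fun k => if k ∈ is then P.nearest (P.assignment f K) lam k
          else Function.update x i (P.nearest (P.assignment f K) lam i) k := by
      funext k
      by_cases hk : k = i
      · subst hk
        simp
      · simp [hk]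
    rw [h3, ← h1, List.map_cons, reconstruct_cons_val, reconstruct_cons_time, h2, List.length_cons]
    exact ⟨rfl, by ring⟩

/-- The cost of one iteration of a breakpoint search. -/
noncomputable def stepCost (n flops : ℕ) : ℕ := 14 * Nat.log 2 (2 * n + 1) + flops + 41

theorem processSub_spec (hn : 0 < n) (P : RapDibc n m) (flops : ℕ) {f : Fin n → Fin m}
    (hf : Monotone f) {best : Candidate m} (hbest : P.Sound best) :
    P.Sound (P.processSub flops ((List.finRange n).map f) best).val ∧
    (P.processSub flops ((List.finRange n).map f) best).val.V ≤ best.V ∧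
    (∀ K, (∀ i : Fin n, f i ≠ P.last → (i : ℕ) < K) → K ≤ n →
      ∀ y, P.FeasibleFor (P.assignment f K) y →
      (P.processSub flops ((List.finRange n).map f) best).val.V ≤ (P.objective y : EReal)) ∧
    (P.processSub flops ((List.finRange n).map f) best).time ≤ 14 * n * stepCost n flops := by
  obtain ⟨r, hr, h1, h2, h3, h4, h5, h6, h7, h8, h9, h10⟩ := P.setUp_spec flops f (List.finRange n)
    { qA := .nil, qB := .nil, j := fun _ => P.last, B := 0, F := 0, NF := 0, VB := 0 }
    BpQueue.valid_nil BpQueue.valid_nil (by simp; omega) (by simp; omega)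
  simp only [BpQueue.entries_nil, add_zero, zero_add, List.mem_finRange, if_true] at h3 h4 h5 h6 h9
  have hK := P.countSub_le_iff hf
  set K := (P.countSub ((List.finRange n).map f)).val with hKdef
  have hmemA : ∀ e, e ∈ r.qA.entries ↔ e.1 = P.lowBp f e.2 := fun e => by
    rw [h3, Multiset.mem_coe, List.mem_map]
    constructor
    · rintro ⟨i, -, rfl⟩
      rfl
    · exact fun h => ⟨e.2, List.mem_finRange _, Prod.ext h.symm rfl⟩
  have hmemB : ∀ e, e ∈ r.qB.entries ↔ e.1 = P.highBp f e.2 := fun e => by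
    rw [h4, Multiset.mem_coe, List.mem_map]
    constructor
    · rintro ⟨i, -, rfl⟩
      rfl
    · exact fun h => ⟨e.2, List.mem_finRange _, Prod.ext h.symm rfl⟩
  have hc : Consistent P r (fun _ => .low) := {
    validA := h1
    validB := h2
    nodupA := by
      rw [h3, Multiset.coe_nodup]
      exact (List.nodup_finRange n).map fun i k h => (Prod.ext_iff.1 h).2
    nodupB := by
      rw [h4, Multiset.coe_nodup]
      exact (List.nodup_finRange n).map fun i k h => (Prod.ext_iff.1 h).2
    entryA := fun e he => .inl (by rw [h5]; exact (hmemA e).1 he)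
    entryB := fun e he => .inl (by rw [h5]; exact (hmemB e).1 he)
    memA := fun i => by simp [hmemA, h5]
    memB := fun i => by simp [hmemB, h5]
    B_eq := by simp [h6, h5, Fin.sum_univ_def]
    F_eq := by simp [h7]
    NF_eq := by simp [h8]
    VB_eq := by simp [h9, h5, Fin.sum_univ_def] }
  -- A fresh search starts at ⊥, where every activity sits at its lower bound.
  have hs : Searching P ⊥ r (fun _ => .low) :=
    ⟨fun _ _ => bot_le, fun _ _ => bot_le, by simp, by simp, .inl rfl⟩
  have hj : r.j = P.assignment f K := by
    rw [h5]
    funext i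
    rw [assignment, if_neg]
    rintro ⟨h', h''⟩
    exact absurd ((hK i).2 h') (not_le.2 h'')
  obtain ⟨i1, i2, i3, i4⟩ := sweep_spec hn flops ((List.finRange n).drop K) hc hs hj rfl
    (fun i => (hK i).1) hbest
  have hval : (P.processSub flops ((List.finRange n).map f) best).val =
      (P.sweep flops ((List.finRange n).map f) ((List.finRange n).drop K) K r best).val := by
    simp only [processSub, val_bind, hr, hKdef]
  have htime : (P.processSub flops ((List.finRange n).map f) best).time =
      n + ((P.setUp flops (List.finRange n) ((List.finRange n).map f)
        { qA := .nil, qB := .nil, j := fun _ => P.last, B := 0, F := 0, NF := 0, VB := 0 }).time +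
      ((2 * n + 1) + (n +
        (P.sweep flops ((List.finRange n).map f) ((List.finRange n).drop K) K r best).time))) := by
    simp only [processSub, time_bind, hr, hKdef, time_tick, time_countSub, List.length_map,
      List.length_finRange]
  rw [hval]
  refine ⟨i1, i2, fun K' hK' hKn y hy => i3 K' ?_ hKn y hy, ?_⟩
  -- Otherwise activity K' would lie outside the last interval, and the hypothesis on K' would give
  -- K' < K'.
  · by_contra hlt
    rw [not_le] at hlt
    have hKn' : K ≤ n := by
      rw [hKdef, val_countSub_map]
      exact List.countP_le_length.trans (by simp)
    exact absurd (hK' ⟨K', by omega⟩ fun h => absurd ((hK _).2 h) (not_le.2 hlt)) (lt_irrefl _)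
  · rw [htime]
    -- In units of n iterations: 1 for the set-up, at most 12 for the sweep, since 2n + 5(n + 1) ≤
    -- 12n, and 1 for the remaining linear work.
    have q1 : queueSize r = 2 * n := by
      simp [queueSize, h3, h4]
      ring
    rw [q1] at i4
    simp only [List.length_finRange] at h10
    have q2 : ((List.finRange n).drop K).length ≤ n := by simp
    have q3 : (2 * n + 5 * (((List.finRange n).drop K).length + 1)) * stepCost n flops ≤
        (2 * n + 5 * (n + 1)) * stepCost n flops := Nat.mul_le_mul_right _ (by omega)
    have q4 : n * (14 * Nat.log 2 (2 * n + 1) + flops + 40) ≤ n * stepCost n flops :=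
      Nat.mul_le_mul_left _ (by rw [stepCost]; omega)
    have q5 : n * 41 ≤ n * stepCost n flops := Nat.mul_le_mul_left _ (by rw [stepCost]; omega)
    have q6 : 1 * stepCost n flops ≤ n * stepCost n flops := Nat.mul_le_mul_right _ hn
    rw [← stepCost] at i4
    nlinarith

theorem processAll_spec (hn : 0 < n) (P : RapDibc n m) (flops : ℕ) (subs : List (List (Fin m)))
    (hsubs : ∀ sub ∈ subs, ∃ f : Fin n → Fin m, Monotone f ∧ sub = (List.finRange n).map f)
    {best : Candidate m} (hbest : P.Sound best) :
    P.Sound (P.processAll flops subs best).val ∧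
    (P.processAll flops subs best).val.V ≤ best.V ∧
    (∀ f : Fin n → Fin m, (List.finRange n).map f ∈ subs →
      ∀ K, (∀ i : Fin n, f i ≠ P.last → (i : ℕ) < K) → K ≤ n →
      ∀ y, P.FeasibleFor (P.assignment f K) y →
      (P.processAll flops subs best).val.V ≤ (P.objective y : EReal)) ∧
    (P.processAll flops subs best).time ≤ subs.length * (14 * n * stepCost n flops + 1) := by
  induction subs generalizing best with
  | nil => exact ⟨hbest, le_rfl, by simp, by simp [processAll]⟩
  | cons sub subs ih =>
    obtain ⟨f, hf, rfl⟩ := hsubs _ List.mem_cons_self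
    obtain ⟨h1, h2, h3, h4⟩ := processSub_spec hn P flops hf hbest
    obtain ⟨i1, i2, i3, i4⟩ := ih (fun sub h => hsubs sub (List.mem_cons_of_mem _ h)) h1
    have hval : (P.processAll flops ((List.finRange n).map f :: subs) best).val =
        (P.processAll flops subs (P.processSub flops ((List.finRange n).map f) best).val).val := rfl
    have htime : (P.processAll flops ((List.finRange n).map f :: subs) best).time =
        1 + ((P.processSub flops ((List.finRange n).map f) best).time +
        (P.processAll flops subs (P.processSub flops ((List.finRange n).map f) best).val).time) :=
      rfl
    rw [hval]
    refine ⟨i1, i2.trans h2, fun g hg K hK hKn y hy => ?_, ?_⟩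
    · rcases List.mem_cons.1 hg with hg | hg
      · obtain rfl : g = f := by
          funext i
          exact List.map_inj_left.1 hg i (List.mem_finRange i)
        exact i2.trans (h3 K hK hKn y hy)
      · exact i3 g hg K hK hKn y hy
    · rw [htime, List.length_cons, add_mul]
      linarith

/-- Every monotone assignment belongs to a partition vector. -/
theorem exists_assignment_eq (P : RapDibc n m) {a : Fin n → Fin m} (ha : Monotone a) :
    ∃ f : Fin n → Fin m, ∃ K, Monotone f ∧ (∀ i, f i ≠ P.penult) ∧
      (∀ i : Fin n, f i ≠ P.last → (i : ℕ) < K) ∧ K ≤ n ∧ P.assignment f K = a := by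
  have hpl := P.penult_lt_last
  have hK := P.countSub_le_iff ha
  set K := (P.countSub ((List.finRange n).map a)).val with hKdef
  have hKn : K ≤ n := by
    rw [hKdef, val_countSub_map]
    exact List.countP_le_length.trans (by simp)
  -- The sweep starts with the last two intervals merged into the last one. K is the number of
  -- activities that a puts outside the last interval, so moving the first K activities restores a.
  refine ⟨fun i => if a i = P.penult then P.last else a i, K, fun i k hik => ?_, fun i => ?_,
    fun i hi => ?_, hKn, ?_⟩
  · have h1 := ha hik
    have h2 := P.le_last (a i)
    simp only
    split_ifs with h3 h4 h4
    · exact le_rfl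
    · have h5 : P.penult < a k := lt_of_le_of_ne (h3 ▸ h1) (Ne.symm h4)
      rw [Fin.lt_def] at h5
      rw [Fin.le_def]
      simp only [penult, last] at h5 ⊢
      omega
    · exact h2
    · exact h1
  · simp only
    split_ifs with h3
    · exact hpl.ne'
    · exact h3
  · by_contra h
    have h' := (hK i).1 (not_lt.1 h)
    simp [h', hpl.ne'] at hi
  · funext i
    have h1 := hK i
    simp only [assignment]
    by_cases h2 : a i = P.penult
    · have h3 : (i : ℕ) < K := by
        by_contra h
        rw [h1.1 (not_lt.1 h)] at h2
        exact hpl.ne' h2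
      simp [h2, h3]
    · by_cases h3 : a i = P.last
      · have h4 := h1.2 h3
        simp [h3, hpl.ne', h4]
      · simp [h2, h3]

theorem refinedAlgorithm_spec (hn : 0 < n) (P : RapDibc n m) (flops : ℕ)
    (hcond : (P.F1 ∧ P.L1) ∨ (P.F1 ∧ P.L2) ∨ (P.F2 ∧ P.L1) ∨ (P.F2 ∧ P.L2)) :
    P.IsCorrectAnswer (P.refinedAlgorithm flops).val ∧
    (P.refinedAlgorithm flops).time ≤
      15 * (n * (n + m - 2).choose (m - 2)) * stepCost n flops := by
  obtain ⟨h1, -, h3, h4⟩ := processAll_spec hn P flops P.subpartitions.val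
    (fun sub hsub => by
      obtain ⟨f, hf, -, rfl⟩ := (P.mem_subpartitions sub).1 hsub
      exact ⟨f, hf, rfl⟩) (best := { V := ⊤, lam := ⊤, sub := [], K := 0 }) (.inl rfl)
  set best := (P.processAll flops P.subpartitions.val
    { V := ⊤, lam := ⊤, sub := [], K := 0 }).val with hbest
  -- The exchange argument supplies a non-decreasing assignment, and every such assignment is
  -- visited by some sweep.
  have hopt : ∀ y, P.Feasible y → best.V ≤ (P.objective y : EReal) := fun y hy => by
    obtain ⟨x, a, ha, hxa, hxy⟩ := P.exists_monotone_assignment hcond hy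
    obtain ⟨f, K, hf, hfp, hfK, hKn, rfl⟩ := P.exists_assignment_eq ha
    refine (h3 f ((P.mem_subpartitions _).2 ⟨f, hf, hfp, rfl⟩) K hfK hKn x hxa).trans ?_
    exact EReal.coe_le_coe_iff.2 hxy
  have hS : 1 ≤ (n + m - 2).choose (m - 2) := by
    have := P.two_le
    exact Nat.choose_pos (by omega)
  have t1 := P.time_subpartitions_le hn
  rw [P.length_subpartitions] at h4
  have hW : 41 ≤ stepCost n flops := by rw [stepCost]; omega
  have hnS : n ≤ n * (n + m - 2).choose (m - 2) := Nat.le_mul_of_pos_right _ hS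
  have hSn : (n + m - 2).choose (m - 2) ≤ n * (n + m - 2).choose (m - 2) :=
    Nat.le_mul_of_pos_left _ hn
  have hnSW := Nat.mul_le_mul_left (n * (n + m - 2).choose (m - 2)) hW
  rw [show (n + m - 2).choose (m - 2) * (14 * n * stepCost n flops + 1) =
    14 * (n * (n + m - 2).choose (m - 2) * stepCost n flops) + (n + m - 2).choose (m - 2) by ring]
    at h4
  rw [show 15 * (n * (n + m - 2).choose (m - 2)) * stepCost n flops =
    15 * (n * (n + m - 2).choose (m - 2) * stepCost n flops) by ring]
  by_cases hV : best.V = ⊤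
  · have hval : (P.refinedAlgorithm flops).val = none := by
      simp [refinedAlgorithm, ← hbest, hV]
    have htime : (P.refinedAlgorithm flops).time = P.subpartitions.time +
        ((P.processAll flops P.subpartitions.val
          { V := ⊤, lam := ⊤, sub := [], K := 0 }).time + 1) := by
      simp [refinedAlgorithm, ← hbest, hV]
    rw [hval, htime]
    refine ⟨?_, by linarith⟩
    rintro ⟨y, hy⟩
    have := hopt y hy
    rw [hV, top_le_iff] at this
    exact EReal.coe_ne_top _ this
  · obtain ⟨f, t, hsub, hlam, hsum, hVt⟩ := h1.resolve_left hV
    obtain ⟨r1, r2⟩ := P.reconstruct_spec t best.K f (List.finRange n) (fun _ => 0)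
    simp only [List.mem_finRange, if_true] at r1
    have hval : (P.refinedAlgorithm flops).val =
        some (P.nearest (P.assignment f best.K) t) := by
      simp [refinedAlgorithm, ← hbest, hV, hsub, hlam, r1]
    have htime : (P.refinedAlgorithm flops).time = P.subpartitions.time +
        ((P.processAll flops P.subpartitions.val
          { V := ⊤, lam := ⊤, sub := [], K := 0 }).time + (1 + (n + 13 * n))) := by
      simp [refinedAlgorithm, ← hbest, hV, hsub, hlam, r2]
    rw [hval, htime]
    refine ⟨⟨⟨hsum, fun i => ⟨_, P.nearest_mem _ _ i⟩⟩, fun y hy => ?_⟩, by linarith⟩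
    have := hopt y hy
    rw [hVt] at this
    exact_mod_cast this

end RapDibc

/-! ### Conversion to the stated bound -/

/-- Since 2n + 1 ≤ 3n, this follows from log 2 > 1/2 and log 3 ≤ 2 log 2. The additive constant is
needed because log n vanishes at n = 1. -/
theorem Nat.log_two_two_mul_add_one_le {n : ℕ} (hn : 1 ≤ n) :
    (Nat.log 2 (2 * n + 1) : ℝ) ≤ 2 * Real.log n + 2 := by
  have h1 : ((2 : ℕ) ^ Nat.log 2 (2 * n + 1) : ℝ) ≤ 3 * n := by
    have h := Nat.pow_log_le_self 2 (x := 2 * n + 1) (by omega)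
    have h' : 2 ^ Nat.log 2 (2 * n + 1) ≤ 3 * n := by omega
    exact_mod_cast h'
  have hn' : (0 : ℝ) < n := by exact_mod_cast hn
  have h2 := Real.log_le_log (by positivity) h1
  rw [Real.log_pow, Real.log_mul (by norm_num) hn'.ne'] at h2
  have h3 := Real.log_two_gt_d9
  have h4 : Real.log 3 ≤ 2 * Real.log 2 := by
    rw [← Real.log_rpow (by norm_num)]
    exact Real.log_le_log (by norm_num) (by norm_num)
  have h5 : 0 ≤ Real.log n := Real.log_natCast_nonneg n
  push_cast at h2
  have h6 : (0 : ℝ) ≤ Nat.log 2 (2 * n + 1) := Nat.cast_nonneg _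
  by_contra hcon
  nlinarith

theorem theorem1 :
    ∃ C : ℝ, 0 < C ∧
      ∀ (n m flops : ℕ) (P : RapDibc n m), 1 ≤ n → 1 ≤ flops →
        ((P.F1 ∧ P.L1) ∨ (P.F1 ∧ P.L2) ∨ (P.F2 ∧ P.L1) ∨ (P.F2 ∧ P.L2)) →
          P.IsCorrectAnswer (P.refinedAlgorithm flops).val ∧
          ((P.refinedAlgorithm flops).time : ℝ) ≤
            C * ((n + m - 2).choose (m - 2) : ℝ) *
              ((n : ℝ) * Real.log n + (n : ℝ) * (flops : ℝ)) := by
  -- 1050 = 15 · 70, where 14 (2 log n + 2) + flops + 41 ≤ 70 (log n + flops). The constant 69 is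
  -- absorbed by flops ≥ 1, which also covers n = 1.
  refine ⟨1050, by norm_num, fun n m flops P hn hflops hcond => ?_⟩
  obtain ⟨h1, h2⟩ := P.refinedAlgorithm_spec hn flops hcond
  refine ⟨h1, ?_⟩
  have h3 := Nat.log_two_two_mul_add_one_le hn
  have h4 : 0 ≤ Real.log n := Real.log_natCast_nonneg n
  have h5 : (1 : ℝ) ≤ flops := by exact_mod_cast hflops
  have h6 : ((P.refinedAlgorithm flops).time : ℝ) ≤
      15 * (n * (n + m - 2).choose (m - 2)) * (14 * Nat.log 2 (2 * n + 1) + flops + 41) := by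
    rw [RapDibc.stepCost] at h2
    exact_mod_cast h2
  refine h6.trans ?_
  rw [show (1050 : ℝ) * ((n + m - 2).choose (m - 2) : ℝ) * (n * Real.log n + n * flops) =
    15 * (n * (n + m - 2).choose (m - 2)) * (70 * (Real.log n + flops)) by ring]
  exact mul_le_mul_of_nonneg_left (by linarith) (by positivity)
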